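/- All graphs are finite, simple and undirected, with at least one vertex. The average degree of a graph $G$ is $2|E(G)|/|V(G)|$. A graph $G$ is *robust* if for every vertex $v \in V(G)$, every connected component of the subgraph $G[N(v)]$ induced by the neighborhood of $v$ has at least $5$ vertices. A nonempty set $V_0 \subseteq V(G)$ is *reducible* if there exist a set $\mathcal{S}$ of pairwise edge-disjoint triangles in $G$ and a set $X \subseteq E(G)$ such that 1. $|X| \le 2|\mathcal{S}|$; 2. the graph $G - X$ has no triangle containing a vertex of $V_0$; and 3. $X$ contains every edge of a triangle in $\mathcal{S}$ whose endpoints are both outside $V_0$. **Lemma.** Every robust graph with average degree less than $7$ has a reducible set. -/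

import Mathlib

namespace Tuza

/-- The average degree `2|E(G)| / |V(G)|` of a finite graph (meaningful when `V` is nonempty). -/
noncomputable def averageDegree {V : Type*} (G : SimpleGraph V) : ℚ :=
  2 * (G.edgeSet.ncard : ℚ) / (Nat.card V : ℚ)

/-- A graph is robust if, for every vertex `v`, every connected component of the subgraph
induced by the (open) neighborhood of `v` has at least five vertices. -/
def IsRobust {V : Type*} (G : SimpleGraph V) : Prop :=
  ∀ v : V, ∀ C : (G.induce (G.neighborSet v)).ConnectedComponent, 5 ≤ C.supp.ncard

/-- The edges of the triangle with vertex set `t`: all pairs of distinct vertices in `t`. -/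
def triangleEdges {V : Type*} (t : Finset V) : Set (Sym2 V) :=
  {e | ¬ e.IsDiag ∧ ∀ v ∈ e, v ∈ t}

/-- `V₀` is reducible using the set `S` of triangles (each given by its vertex set)
and the set `X` of edges. -/
structure IsReducibleUsing {V : Type*} (G : SimpleGraph V) (V₀ : Set V)
    (S : Finset (Finset V)) (X : Finset (Sym2 V)) : Prop where
  nonempty : V₀.Nonempty
  triangles : ∀ t ∈ S, G.IsNClique 3 t
  edgeDisjoint : ∀ t ∈ S, ∀ t' ∈ S, t ≠ t' → Disjoint (triangleEdges t) (triangleEdges t')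
  edges : ∀ e ∈ X, e ∈ G.edgeSet
  card_le : X.card ≤ 2 * S.card
  no_triangle : ∀ t : Finset V,
    (G.deleteEdges (X : Set (Sym2 V))).IsNClique 3 t → ∀ v ∈ t, v ∉ V₀
  outside_mem : ∀ t ∈ S, ∀ e ∈ triangleEdges t, (∀ v ∈ e, v ∉ V₀) → e ∈ X

/-- A set of vertices is reducible if it is reducible using some `S` and `X`. -/
def IsReducible {V : Type*} (G : SimpleGraph V) (V₀ : Set V) : Prop :=
  ∃ (S : Finset (Finset V)) (X : Finset (Sym2 V)), IsReducibleUsing G V₀ S X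

end Tuza

/-!
Suppose that the robust graph `G` has no reducible set. Local structure plus discharging then show
that the average degree of `G` is at least 7.

Reducibility is only ever used with one to three vertices in `V₀` whose neighbourhoods are listed
explicitly. Such a set is exhibited by a *certificate*: triangles and edges on natural-number labels
for which the conditions on a reducible set can be checked by `decide`
(`isReducible_of_certificate`). Vertices outside the listed neighbourhoods play no role, and
listed vertices may coincide as long as the triangles stay edge-disjoint, so finitely many
certificates, the lemmas `conf_*`, cover all graphs. Robustness enters through
`IsRobust.exists_adj_not_mem`: one to four neighbours of `v` always have a neighbour in `N(v)`
outside of them. In particular all degrees are at least 5.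

Call a vertex *low* if its degree is 5 or 6. The facts about low vertices are:
* the non-edges inside `N(u)` form a matching (`IsLow.adj_or_adj`), and there is at most one of them
  if `u` has degree 5 (`five_nonadj`);
* low vertices are not adjacent (`IsLow.not_adj`), and two of them have at most three common
  neighbours (`IsLow.false_of_four_common`); this improves by one at a common neighbour `v` which
  misses another neighbour of a 5-vertex (`five_low_false_of_two_common`);
* a 5-vertex has at most one neighbour of degree 7 (`five_at_most_one_seven`), and a 6-vertex has at
  most four (`six_at_most_four_seven`).

Hence a low vertex `u` has at least `2 (7 - deg u)` neighbours of degree at least 8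
(`low_card_high_nbrs`). Conversely a vertex `v` of degree `d ≥ 8` has at most `2 (d - 7)` low
neighbours (`high_card_low_nbrs`): if there are at least three, then the sets `N(u) ∩ N(v)` of the
low neighbours `u` of `v` consist of neighbours that are not low, and they are so large and overlap
so little that at least six neighbours of `v` are not low, whence at most `d - 6 ≤ 2 (d - 7)` are.
Counting the edges between low vertices and vertices of degree at least 8 from both sides gives
`∑ (deg v - 7) ≥ 0`.
-/

namespace Tuza

variable {V : Type*} {G : SimpleGraph V}

/-! ### Certificates of reducibility -/

/-- `NbrList G v l`: the list `l` enumerates the neighbours of `v` without repetition. -/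
def NbrList (G : SimpleGraph V) (v : V) (l : List V) : Prop :=
  l.Nodup ∧ ∀ x, G.Adj v x ↔ x ∈ l

theorem NbrList.adj {v : V} {l : List V} (h : NbrList G v l) {x : V} (hx : x ∈ l) : G.Adj v x :=
  (h.2 x).2 hx

theorem NbrList.nodup_cons {v : V} {l : List V} (h : NbrList G v l) : (v :: l).Nodup :=
  List.nodup_cons.2 ⟨fun hv => G.irrefl (h.adj hv), h.1⟩

/-- Membership of the unordered pair `{i, j}` in a list of pairs. -/
def PairMem (i j : ℕ) (l : List (ℕ × ℕ)) : Prop := (i, j) ∈ l ∨ (j, i) ∈ l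

instance (i j : ℕ) (l : List (ℕ × ℕ)) : Decidable (PairMem i j l) := by
  unfold PairMem; infer_instance

/-- The pair `{i, j}` of labels is an edge according to the adjacency lists `N` or the list `A` of
edges. -/
def KnownAdj (N : List (ℕ × List ℕ)) (A : List (ℕ × ℕ)) (i j : ℕ) : Prop :=
  PairMem i j A ∨ ∃ p ∈ N, i = p.1 ∧ j ∈ p.2 ∨ j = p.1 ∧ i ∈ p.2

instance (N : List (ℕ × List ℕ)) (A : List (ℕ × ℕ)) (i j : ℕ) : Decidable (KnownAdj N A i j) := by
  unfold KnownAdj; infer_instance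

/-- The labels `i` and `j` stand for distinct vertices: they are both in the closed neighbourhood
listed for some vertex, or they are listed in `Q`, or `j` is a neighbour of a vertex to which `i` is
non-adjacent by `F` (or vice versa). -/
def KnownNe (N : List (ℕ × List ℕ)) (F Q : List (ℕ × ℕ)) (i j : ℕ) : Prop :=
  PairMem i j Q ∨ ∃ p ∈ N, (i ∈ p.1 :: p.2 ∧ j ∈ p.1 :: p.2) ∨ (PairMem p.1 i F ∧ j ∈ p.2) ∨
    (PairMem p.1 j F ∧ i ∈ p.2)

instance (N : List (ℕ × List ℕ)) (F Q : List (ℕ × ℕ)) (i j : ℕ) :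
    Decidable (KnownNe N F Q i j) := by
  unfold KnownNe; infer_instance

/-- The combinatorial content of a reducibility certificate, on labels in `ℕ`. The list `N` pairs
each label of a vertex of `V₀` with the labels of its neighbours; `A`, `F` and `Q` list pairs known
to be adjacent, non-adjacent and distinct; `S` lists triangles and `X` lists edges. -/
def IsCertificate (N : List (ℕ × List ℕ)) (A F Q : List (ℕ × ℕ)) (S : List (ℕ × ℕ × ℕ))
    (X : List (ℕ × ℕ)) : Prop :=
  (N ≠ [] ∧ X.length ≤ 2 * S.length ∧ S.Nodup) ∧
  (∀ t ∈ S, KnownAdj N A t.1 t.2.1 ∧ KnownAdj N A t.1 t.2.2 ∧ KnownAdj N A t.2.1 t.2.2) ∧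
  (∀ t ∈ S, ∀ i ∈ [t.1, t.2.1, t.2.2], ∀ t' ∈ S, ∀ j ∈ [t'.1, t'.2.1, t'.2.2],
    i = j ∨ KnownNe N F Q i j) ∧
  (∀ t ∈ S, ∀ t' ∈ S, t = t' ∨ ∀ i ∈ [t.1, t.2.1, t.2.2], ∀ j ∈ [t.1, t.2.1, t.2.2],
    i = j ∨ i ∉ [t'.1, t'.2.1, t'.2.2] ∨ j ∉ [t'.1, t'.2.1, t'.2.2]) ∧
  (∀ t ∈ S, ∀ i ∈ [t.1, t.2.1, t.2.2], ∀ j ∈ [t.1, t.2.1, t.2.2],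
    i = j ∨ i ∈ N.map Prod.fst ∨ j ∈ N.map Prod.fst ∨ PairMem i j X) ∧
  ∀ p ∈ N, ∀ i ∈ p.2, ∀ j ∈ p.2, i = j ∨ PairMem p.1 i X ∨ PairMem p.1 j X ∨ PairMem i j X ∨
    PairMem i j F

instance (N : List (ℕ × List ℕ)) (A F Q : List (ℕ × ℕ)) (S : List (ℕ × ℕ × ℕ))
    (X : List (ℕ × ℕ)) : Decidable (IsCertificate N A F Q S X) := by
  unfold IsCertificate; infer_instance

/-- A certificate on labels yields a reducible set once the labels are interpreted by `φ`. Only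
the labels occurring in the triangles of `S` have to be interpreted injectively, so that the other
vertices may coincide. Pairs in `X` that are not edges of `G` are discarded. -/
theorem isReducible_of_certificate (φ : ℕ → V) (N : List (ℕ × List ℕ)) (A F Q : List (ℕ × ℕ))
    (S : List (ℕ × ℕ × ℕ)) (X : List (ℕ × ℕ)) (hc : IsCertificate N A F Q S X)
    (hN : ∀ p ∈ N, NbrList G (φ p.1) (p.2.map φ)) (hA : ∀ p ∈ A, G.Adj (φ p.1) (φ p.2))
    (hF : ∀ p ∈ F, ¬ G.Adj (φ p.1) (φ p.2)) (hQ : ∀ p ∈ Q, φ p.1 ≠ φ p.2) :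
    ∃ V₀ : Set V, IsReducible G V₀ := by
  classical
  obtain ⟨⟨hne, hcard, hSnd⟩, hSA, hSD, hdisj, hout, htri⟩ := hc
  have hknown : ∀ i j, KnownAdj N A i j → G.Adj (φ i) (φ j) := by
    rintro i j ((h | h) | ⟨p, hp, ⟨rfl, h⟩ | ⟨rfl, h⟩⟩)
    · exact hA _ h
    · exact (hA _ h).symm
    · exact (hN p hp).adj (List.mem_map_of_mem h)
    · exact ((hN p hp).adj (List.mem_map_of_mem h)).symm
  have hS : ∀ t ∈ S, G.Adj (φ t.1) (φ t.2.1) ∧ G.Adj (φ t.1) (φ t.2.2) ∧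
      G.Adj (φ t.2.1) (φ t.2.2) := fun t ht =>
    ⟨hknown _ _ (hSA t ht).1, hknown _ _ (hSA t ht).2.1, hknown _ _ (hSA t ht).2.2⟩
  have hnonadj : ∀ i j, PairMem i j F → ¬ G.Adj (φ i) (φ j) := by
    rintro i j (h | h) ha
    · exact hF _ h ha
    · exact hF _ h ha.symm
  have hinj : ∀ i j, KnownNe N F Q i j → φ i = φ j → i = j := by
    rintro i j ((h | h) | ⟨p, hp, h | h | h⟩) e
    · exact absurd e (hQ _ h)
    · exact absurd e.symm (hQ _ h)
    · exact List.inj_on_of_nodup_map (l := p.1 :: p.2) (hN p hp).nodup_cons h.1 h.2 e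
    · refine absurd ?_ (hnonadj _ _ h.1)
      rw [e]; exact (hN p hp).adj (List.mem_map_of_mem h.2)
    · refine absurd ?_ (hnonadj _ _ h.1)
      rw [← e]; exact (hN p hp).adj (List.mem_map_of_mem h.2)
  set V₀ : Set V := {v | v ∈ N.map (fun p => φ p.1)} with hV₀
  let T : ℕ × ℕ × ℕ → Finset V := fun t => {φ t.1, φ t.2.1, φ t.2.2}
  have hT : ∀ t x, x ∈ T t ↔ ∃ i ∈ [t.1, t.2.1, t.2.2], x = φ i := by
    intro t x; simp [T]
  -- two triangles of `S` have at most one vertex in common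
  have hshare : ∀ t ∈ S, ∀ t' ∈ S, t ≠ t' →
      ∀ x y, x ∈ T t → y ∈ T t → x ∈ T t' → y ∈ T t' → x = y := by
    intro t ht t' ht' htt x y hx hy hx' hy'
    rw [hT] at hx hy hx' hy'
    obtain ⟨i, hi, rfl⟩ := hx
    obtain ⟨j, hj, rfl⟩ := hy
    obtain ⟨i', hi', e1⟩ := hx'
    obtain ⟨j', hj', e2⟩ := hy'
    have := (hSD t ht i hi t' ht' i' hi').elim id (hinj _ _ · e1)
    have := (hSD t ht j hj t' ht' j' hj').elim id (hinj _ _ · e2)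
    subst_vars
    rcases (hdisj t ht t' ht').resolve_left htt _ hi _ hj with h | h | h
    · rw [h]
    · exact absurd hi' h
    · exact absurd hj' h
  have hTinj : ∀ t ∈ S, ∀ t' ∈ S, T t = T t' → t = t' := by
    intro t ht t' ht' e
    by_contra hne
    refine (hS t ht).1.ne (hshare t ht t' ht' hne _ _ ?_ ?_ ?_ ?_) <;> first | rw [← e] | skip
    all_goals simp [T]
  have hnd : (S.map T).Nodup := hSnd.map_on hTinj
  let XX : Finset (Sym2 V) := ((X.map (fun p => s(φ p.1, φ p.2))).toFinset).filter (· ∈ G.edgeSet)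
  have hXX : ∀ i j, PairMem i j X → G.Adj (φ i) (φ j) → s(φ i, φ j) ∈ XX := by
    intro i j h ha
    simp only [XX, Finset.mem_filter, List.mem_toFinset, List.mem_map, SimpleGraph.mem_edgeSet]
    refine ⟨?_, ha⟩
    rcases h with h | h
    · exact ⟨_, h, rfl⟩
    · exact ⟨_, h, Sym2.eq_swap⟩
  have hadj : ∀ t ∈ S, ∀ x ∈ T t, ∀ y ∈ T t, x ≠ y → G.Adj x y := by
    intro t ht x hx y hy hxy
    obtain ⟨h1, h2, h3⟩ := hS t ht
    simp only [T, Finset.mem_insert, Finset.mem_singleton] at hx hy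
    rcases hx with rfl | rfl | rfl <;> rcases hy with rfl | rfl | rfl <;>
      first
        | exact absurd rfl hxy
        | assumption
        | (apply SimpleGraph.Adj.symm; assumption)
  refine ⟨V₀, (S.map T).toFinset, XX, ?_, ?_, ?_, ?_, ?_, ?_, ?_⟩
  · obtain ⟨p, hp⟩ := List.exists_mem_of_ne_nil _ hne
    exact ⟨φ p.1, List.mem_map.2 ⟨p, hp, rfl⟩⟩
  · intro t ht
    simp only [List.mem_toFinset, List.mem_map] at ht
    obtain ⟨s, hs, rfl⟩ := ht
    exact SimpleGraph.is3Clique_triple_iff.2 (hS s hs)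
  · intro t ht t' ht' hne'
    simp only [List.mem_toFinset, List.mem_map] at ht ht'
    obtain ⟨s, hs, rfl⟩ := ht
    obtain ⟨s', hs', rfl⟩ := ht'
    have key := hshare s hs s' hs' (by rintro rfl; exact hne' rfl)
    rw [Set.disjoint_left]
    rintro e ⟨hd, h1⟩ ⟨-, h2⟩
    induction e with | _ x y
    simp only [Sym2.mem_iff, forall_eq_or_imp, forall_eq, Sym2.mk_isDiag_iff] at hd h1 h2
    exact hd (key x y h1.1 h1.2 h2.1 h2.2)
  · intro e he
    exact (Finset.mem_filter.1 he).2
  · rw [List.toFinset_card_of_nodup hnd, List.length_map]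
    refine le_trans (Finset.card_filter_le _ _) (le_trans (List.toFinset_card_le _) ?_)
    rwa [List.length_map]
  · intro t ht v hv hv0
    obtain ⟨p, hp, rfl⟩ := List.mem_map.1 hv0
    obtain ⟨a, b, c, hab, hac, hbc, rfl⟩ := SimpleGraph.is3Clique_iff.1 ht
    -- the other two vertices of the triangle
    obtain ⟨x, y, hx, hy, hxy⟩ : ∃ x y, (G.deleteEdges (XX : Set (Sym2 V))).Adj (φ p.1) x ∧
        (G.deleteEdges (XX : Set (Sym2 V))).Adj (φ p.1) y ∧
        (G.deleteEdges (XX : Set (Sym2 V))).Adj x y := by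
      simp only [Finset.mem_insert, Finset.mem_singleton] at hv
      rcases hv with h | h | h <;> rw [h]
      · exact ⟨b, c, hab, hac, hbc⟩
      · exact ⟨a, c, hab.symm, hbc, hac⟩
      · exact ⟨a, b, hac.symm, hbc.symm, hab⟩
    simp only [SimpleGraph.deleteEdges_adj] at hx hy hxy
    obtain ⟨i, hi, rfl⟩ := List.mem_map.1 (((hN p hp).2 x).1 hx.1)
    obtain ⟨j, hj, rfl⟩ := List.mem_map.1 (((hN p hp).2 y).1 hy.1)
    have hij : i ≠ j := by rintro rfl; exact G.loopless.irrefl _ hxy.1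
    rcases (htri p hp i hi j hj).resolve_left hij with h | h | h | h
    · exact hx.2 (hXX _ _ h hx.1)
    · exact hy.2 (hXX _ _ h hy.1)
    · exact hxy.2 (hXX _ _ h hxy.1)
    · exact hnonadj _ _ h hxy.1
  · intro t ht e he hev
    simp only [List.mem_toFinset, List.mem_map] at ht
    obtain ⟨s, hs, rfl⟩ := ht
    obtain ⟨hd, h1⟩ := he
    induction e with | _ x y
    simp only [Sym2.mem_iff, forall_eq_or_imp, forall_eq, Sym2.mk_isDiag_iff] at hd h1 hev
    have ha := hadj s hs x h1.1 y h1.2 hd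
    obtain ⟨i, hi, rfl⟩ := (hT _ _).1 h1.1
    obtain ⟨j, hj, rfl⟩ := (hT _ _).1 h1.2
    rcases hout s hs i hi j hj with h | h | h | h
    · exact absurd (by rw [h]) hd
    · obtain ⟨q, hq, rfl⟩ := List.mem_map.1 h
      exact absurd (List.mem_map.2 ⟨q, hq, rfl⟩ : φ q.1 ∈ N.map (fun p => φ p.1)) hev.1
    · obtain ⟨q, hq, rfl⟩ := List.mem_map.1 h
      exact absurd (List.mem_map.2 ⟨q, hq, rfl⟩ : φ q.1 ∈ N.map (fun p => φ p.1)) hev.2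
    · exact hXX _ _ h ha

/-! ### Graphs without reducible sets -/

/-- The graph `G` has no reducible set. -/
def NoReducible (G : SimpleGraph V) : Prop :=
  ¬ ∃ V₀ : Set V, IsReducible G V₀

/-- The order in which the neighbours are listed does not matter. -/
theorem NbrList.reorder {v : V} {l l' : List V} (h : NbrList G v l)
    (hl : l'.length = l.length := by rfl) (hs : l ⊆ l' := by
      simp only [List.cons_append, List.nil_append, List.cons_subset, List.mem_cons, true_or,
        or_true, true_and, List.nil_subset]) : NbrList G v l' := by
  classical
  have hp : l.Perm l' := (h.1.subperm hs).perm_of_length_le hl.le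
  exact ⟨hp.nodup_iff.1 h.1, fun x => (h.2 x).trans hp.mem_iff⟩

theorem NbrList.ncard {v : V} {l : List V} (h : NbrList G v l) :
    (G.neighborSet v).ncard = l.length := by
  classical
  have : G.neighborSet v = (l.toFinset : Set V) := by
    ext x; simp [h.2]
  rw [this, Set.ncard_coe_finset, List.toFinset_card_of_nodup h.1]

theorem exists_nbrList_append [Finite V] (v : V) (l : List V) (hl : l.Nodup)
    (h : ∀ x ∈ l, G.Adj v x) : ∃ r, NbrList G v (l ++ r) := by
  classical
  have := Fintype.ofFinite V
  refine ⟨(G.neighborFinset v \ l.toFinset).toList, ?_, ?_⟩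
  · refine List.Nodup.append hl (Finset.nodup_toList _) ?_
    intro x hx hx'
    simp at hx'
    exact hx'.2 hx
  · intro x
    simp only [List.mem_append, Finset.mem_toList, Finset.mem_sdiff, SimpleGraph.mem_neighborFinset,
      List.mem_toFinset]
    constructor
    · intro hx; tauto
    · rintro (hx | hx)
      · exact h x hx
      · exact hx.1

/-- In a robust graph, a set of fewer than five neighbours of `v` is joined to another neighbour
of `v`. -/
theorem IsRobust.exists_adj_not_mem (hG : IsRobust G) {v : V} {l : List V} (hne : l ≠ [])
    (hlen : l.length ≤ 4) (hl : ∀ x ∈ l, G.Adj v x) :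
    ∃ x ∈ l, ∃ y, y ∉ l ∧ G.Adj v y ∧ G.Adj x y := by
  classical
  by_contra! hcon
  obtain ⟨x₀, hx₀⟩ := List.exists_mem_of_ne_nil _ hne
  let H := G.induce (G.neighborSet v)
  have hwalk : ∀ (a b : G.neighborSet v), H.Walk a b → a.1 ∈ l → b.1 ∈ l := by
    intro a b p
    induction p with
    | nil => exact id
    | @cons a b c hab _ ih =>
      intro ha
      refine ih ?_
      by_contra hb
      exact hcon a.1 ha b.1 hb b.2 hab
  have hsub : Subtype.val '' (H.connectedComponentMk ⟨x₀, hl x₀ hx₀⟩).supp ⊆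
      (l.toFinset : Set V) := by
    rintro _ ⟨z, hz, rfl⟩
    have hz' : H.Reachable ⟨x₀, hl x₀ hx₀⟩ z :=
      (SimpleGraph.ConnectedComponent.eq.1 hz).symm
    obtain ⟨p⟩ := hz'
    simpa using hwalk _ _ p hx₀
  have h1 := Set.ncard_le_ncard hsub (Finset.finite_toSet _)
  rw [Set.ncard_image_of_injective _ Subtype.val_injective, Set.ncard_coe_finset] at h1
  have h2 := hG v (H.connectedComponentMk ⟨x₀, hl x₀ hx₀⟩)
  have h3 := List.toFinset_card_le l
  omega

/-- The form in which certificates are used: the label `i` stands for the `i`-th vertex of `P`, and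
the hypotheses on the vertices are found among the local ones. The set `V₀` consists of the vertices
whose neighbourhoods are listed in `N`; the lists `A`, `F` and `Q` give the edges, non-edges and
distinct pairs needed besides those implied by `N`, and `S` and `X` are the triangles and edges. -/
theorem NoReducible.false_of_certificate (hG : NoReducible G) (P : List V)
    (N : List (ℕ × List ℕ)) (A F Q : List (ℕ × ℕ)) (S : List (ℕ × ℕ × ℕ)) (X : List (ℕ × ℕ))
    (hP : P ≠ [] := by simp) (hc : IsCertificate N A F Q S X := by decide)
    (hN : ∀ p ∈ N, NbrList G (P.getD p.1 (P.head hP)) (p.2.map (P.getD · (P.head hP))) := by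
      simp; grind)
    (hA : ∀ p ∈ A, G.Adj (P.getD p.1 (P.head hP)) (P.getD p.2 (P.head hP)) := by
      simp; try grind [SimpleGraph.adj_comm])
    (hF : ∀ p ∈ F, ¬ G.Adj (P.getD p.1 (P.head hP)) (P.getD p.2 (P.head hP)) := by
      simp; try grind [SimpleGraph.adj_comm])
    (hQ : ∀ p ∈ Q, P.getD p.1 (P.head hP) ≠ P.getD p.2 (P.head hP) := by
      simp; try grind) : False :=
  hG (isReducible_of_certificate _ N A F Q S X hc hN hA hF hQ)

theorem NoReducible.exists_adj (hG : NoReducible G) (v : V) : ∃ x, G.Adj v x := by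
  by_contra! h
  refine hG (isReducible_of_certificate (fun _ => v) [(0, [])] [] [] [] [] [] (by decide)
    ?_ ?_ ?_ ?_) <;> simp [NbrList, h]

theorem five_le_degree [Finite V] (hG : NoReducible G) (hr : IsRobust G) (v : V) :
    5 ≤ (G.neighborSet v).ncard := by
  obtain ⟨x, hx⟩ := hG.exists_adj v
  by_contra! hlt
  obtain ⟨r, hr'⟩ := exists_nbrList_append v [] List.nodup_nil (by simp) (G := G)
  rw [List.nil_append] at hr'
  rw [hr'.ncard] at hlt
  obtain ⟨x, -, y, hy, hvy, -⟩ := hr.exists_adj_not_mem (v := v) (l := r)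
    (by rintro rfl; simp [hr'.2] at hx) (by omega) (fun x hx => hr'.adj hx)
  exact hy ((hr'.2 y).1 hvy)

theorem IsRobust.exists_common_nbr (hr : IsRobust G) {v x : V} (hx : G.Adj v x) :
    ∃ y, G.Adj v y ∧ G.Adj x y := by
  obtain ⟨x', hx', y, -, h1, h2⟩ := hr.exists_adj_not_mem (v := v) (l := [x]) (by simp) (by simp)
    (by simpa using hx)
  rw [List.mem_singleton] at hx'
  exact ⟨y, h1, hx' ▸ h2⟩

/-! ### The neighbourhood of a 5-vertex -/

theorem conf_five_two_edges (hG : NoReducible G) {u a b c d e : V}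
    (hu : NbrList G u [a, b, c, d, e]) (ead : G.Adj a d) (ebc : G.Adj b c) (nab : ¬ G.Adj a b)
    (nac : ¬ G.Adj a c) : False :=
  hG.false_of_certificate [u, a, b, c, d, e]
    [(0, [1, 2, 3, 4, 5])] [(1, 4), (2, 3)] [(1, 2), (1, 3)] [] [(0, 2, 3), (0, 1, 4)]
    [(2, 3), (1, 4), (0, 4), (0, 5)]

theorem conf_five_indep_three (hG : NoReducible G) {u a b c d e : V}
    (hu : NbrList G u [a, b, c, d, e]) (ead : G.Adj a d) (ebe : G.Adj b e) (nab : ¬ G.Adj a b)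
    (nac : ¬ G.Adj a c) (nbc : ¬ G.Adj b c) : False :=
  hG.false_of_certificate [u, a, b, c, d, e]
    [(0, [1, 2, 3, 4, 5])] [(1, 4), (2, 5)] [(1, 2), (1, 3), (2, 3)] [] [(0, 1, 4), (0, 2, 5)]
    [(1, 4), (2, 5), (0, 4), (0, 5)]

theorem conf_five_indep_four (hG : NoReducible G) {u a b c d e : V}
    (hu : NbrList G u [a, b, c, d, e]) (ead : G.Adj a d) (nab : ¬ G.Adj a b) (nac : ¬ G.Adj a c)
    (nae : ¬ G.Adj a e) (nbc : ¬ G.Adj b c) (nbe : ¬ G.Adj b e) (nce : ¬ G.Adj c e) : False :=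
  hG.false_of_certificate [u, a, b, c, d, e]
    [(0, [1, 2, 3, 4, 5])] [(1, 4)] [(1, 2), (1, 3), (1, 5), (2, 3), (2, 5), (3, 5)] [] [(0, 1, 4)]
    [(1, 4), (0, 4)]

theorem five_matching_of_adj (hG : NoReducible G) (hr : IsRobust G) {u a b c d e : V}
    (hu : NbrList G u [a, b, c, d, e]) (ead : G.Adj a d) (nab : ¬ G.Adj a b) (nac : ¬ G.Adj a c) :
    False := by
  by_cases ebc : G.Adj b c
  · exact conf_five_two_edges hG hu ead ebc nab nac
  have hb : G.Adj b d ∨ G.Adj b e := by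
    obtain ⟨y, hy, h⟩ := hr.exists_common_nbr (hu.adj (x := b) (by simp))
    grind [hu.2 y, SimpleGraph.adj_comm, SimpleGraph.irrefl]
  have hc : G.Adj c d ∨ G.Adj c e := by
    obtain ⟨y, hy, h⟩ := hr.exists_common_nbr (hu.adj (x := c) (by simp))
    grind [hu.2 y, SimpleGraph.adj_comm, SimpleGraph.irrefl]
  by_cases ebe : G.Adj b e
  · exact conf_five_indep_three hG hu ead ebe nab nac ebc
  by_cases ece : G.Adj c e
  · exact conf_five_indep_three hG (a := a) (b := c) (c := b) (d := d) (e := e) hu.reorder ead ece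
      nac nab (fun h => ebc h.symm)
  by_cases eae : G.Adj a e
  · exact conf_five_indep_three hG (a := b) (b := a) (c := c) (d := d) (e := e) hu.reorder
      (hb.resolve_right ebe) eae (fun h => nab h.symm) ebc nac
  · exact conf_five_indep_four hG hu ead nab nac eae ebc ebe ece

/-- In the neighbourhood of a 5-vertex, no vertex misses two others. -/
theorem five_matching (hG : NoReducible G) (hr : IsRobust G) {u a b c d e : V}
    (hu : NbrList G u [a, b, c, d, e]) (nab : ¬ G.Adj a b) (nac : ¬ G.Adj a c) : False := by
  obtain ⟨y, hy, h⟩ := hr.exists_common_nbr (hu.adj (x := a) (by simp))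
  have : G.Adj a d ∨ G.Adj a e := by
    grind [hu.2 y, SimpleGraph.irrefl]
  rcases this with h | h
  · exact five_matching_of_adj hG hr hu h nab nac
  · exact five_matching_of_adj hG hr (a := a) (b := b) (c := c) (d := e) (e := d) hu.reorder h nab
      nac

/-! ### The neighbourhood of a 6-vertex -/

theorem conf_six_three_edges (hG : NoReducible G) {u a b c d e f : V}
    (hu : NbrList G u [a, b, c, d, e, f]) (ead : G.Adj a d) (ebc : G.Adj b c) (eef : G.Adj e f)
    (nab : ¬ G.Adj a b) (nac : ¬ G.Adj a c) : False :=
  hG.false_of_certificate [u, a, b, c, d, e, f]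
    [(0, [1, 2, 3, 4, 5, 6])] [(1, 4), (2, 3), (5, 6)] [(1, 2), (1, 3)] []
    [(0, 2, 3), (0, 1, 4), (0, 5, 6)] [(2, 3), (1, 4), (5, 6), (0, 4), (0, 5), (0, 6)]

theorem conf_six_indep_three_matched (hG : NoReducible G) {u a b c d e f : V}
    (hu : NbrList G u [a, b, c, d, e, f]) (ead : G.Adj a d) (ebe : G.Adj b e) (ecf : G.Adj c f)
    (nab : ¬ G.Adj a b) (nac : ¬ G.Adj a c) (nbc : ¬ G.Adj b c) : False :=
  hG.false_of_certificate [u, a, b, c, d, e, f]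
    [(0, [1, 2, 3, 4, 5, 6])] [(1, 4), (2, 5), (3, 6)] [(1, 2), (1, 3), (2, 3)] []
    [(0, 1, 4), (0, 2, 5), (0, 3, 6)] [(1, 4), (2, 5), (3, 6), (0, 4), (0, 5), (0, 6)]

theorem conf_six_indep_four_two_edges (hG : NoReducible G) {u a b c d e f : V}
    (hu : NbrList G u [a, b, c, d, e, f]) (ead : G.Adj a d) (ebe : G.Adj b e) (nab : ¬ G.Adj a b)
    (nac : ¬ G.Adj a c) (naf : ¬ G.Adj a f) (nbc : ¬ G.Adj b c) (nbf : ¬ G.Adj b f)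
    (ncf : ¬ G.Adj c f) : False :=
  hG.false_of_certificate [u, a, b, c, d, e, f]
    [(0, [1, 2, 3, 4, 5, 6])] [(1, 4), (2, 5)] [(1, 2), (1, 3), (1, 6), (2, 3), (2, 6), (3, 6)] []
    [(0, 1, 4), (0, 2, 5)] [(1, 4), (2, 5), (0, 4), (0, 5)]

theorem conf_six_indep_four (hG : NoReducible G) {u a b c d e f : V}
    (hu : NbrList G u [a, b, c, d, e, f]) (ead : G.Adj a d) (ebc : G.Adj b c) (nac : ¬ G.Adj a c)
    (nae : ¬ G.Adj a e) (naf : ¬ G.Adj a f) (nce : ¬ G.Adj c e) (ncf : ¬ G.Adj c f)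
    (nef : ¬ G.Adj e f) : False :=
  hG.false_of_certificate [u, a, b, c, d, e, f]
    [(0, [1, 2, 3, 4, 5, 6])] [(1, 4), (2, 3)] [(1, 3), (1, 5), (1, 6), (3, 5), (3, 6), (5, 6)] []
    [(0, 1, 4), (0, 2, 3)] [(1, 4), (2, 3), (0, 4), (0, 2)]

theorem conf_six_edge_missed_twice (hG : NoReducible G) {u a b c d e f : V}
    (hu : NbrList G u [a, b, c, d, e, f]) (ead : G.Adj a d) (ebc : G.Adj b c) (nab : ¬ G.Adj a b)
    (nac : ¬ G.Adj a c) (naf : ¬ G.Adj a f) (nbf : ¬ G.Adj b f) (ncf : ¬ G.Adj c f) : False :=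
  hG.false_of_certificate [u, a, b, c, d, e, f]
    [(0, [1, 2, 3, 4, 5, 6])] [(1, 4), (2, 3)] [(1, 2), (1, 3), (1, 6), (2, 6), (3, 6)] []
    [(0, 1, 4), (0, 2, 3)] [(1, 4), (2, 3), (0, 4), (0, 5)]

theorem conf_six_indep_five (hG : NoReducible G) {u a b c d e f : V}
    (hu : NbrList G u [a, b, c, d, e, f]) (ead : G.Adj a d) (nab : ¬ G.Adj a b) (nac : ¬ G.Adj a c)
    (nae : ¬ G.Adj a e) (naf : ¬ G.Adj a f) (nbc : ¬ G.Adj b c) (nbe : ¬ G.Adj b e)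
    (nbf : ¬ G.Adj b f) (nce : ¬ G.Adj c e) (ncf : ¬ G.Adj c f) (nef : ¬ G.Adj e f) : False :=
  hG.false_of_certificate [u, a, b, c, d, e, f]
    [(0, [1, 2, 3, 4, 5, 6])] [(1, 4)]
    [(1, 2), (1, 3), (1, 5), (1, 6), (2, 3), (2, 5), (2, 6), (3, 5), (3, 6), (5, 6)] [] [(0, 1, 4)]
    [(1, 4), (0, 4)]

theorem six_pendant_aux (hG : NoReducible G) {u a b c d e f : V}
    (hu : NbrList G u [a, b, c, d, e, f]) (ead : G.Adj a d) (nab : ¬ G.Adj a b)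
    (nac : ¬ G.Adj a c) (nae : ¬ G.Adj a e) (naf : ¬ G.Adj a f) (ebc : G.Adj b c) : False := by
  have ecb := ebc.symm
  have h1 : ¬ G.Adj e f := fun h => conf_six_three_edges hG hu ead ebc h nab nac
  have h2 : ¬ (G.Adj b e ∧ G.Adj c f) := fun h =>
    conf_six_three_edges hG (a := a) (b := b) (c := e) (d := d) (e := c) (f := f) hu.reorder ead
      h.1 h.2 nab nae
  have h3 : ¬ (G.Adj b f ∧ G.Adj c e) := fun h =>
    conf_six_three_edges hG (a := a) (b := b) (c := f) (d := d) (e := c) (f := e) hu.reorder ead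
      h.1 h.2 nab naf
  have h4 : G.Adj b f ∨ G.Adj c f := by
    by_contra! h; exact conf_six_edge_missed_twice hG hu ead ebc nab nac naf h.1 h.2
  have h5 : G.Adj b e ∨ G.Adj c e := by
    by_contra! h
    exact conf_six_edge_missed_twice hG (a := a) (b := b) (c := c) (d := d) (e := f) (f := e)
      hu.reorder ead ebc nab nac nae h.1 h.2
  have h6 : G.Adj c e ∨ G.Adj c f := by
    by_contra! h; exact conf_six_indep_four hG hu ead ebc nac nae naf h.1 h.2 h1
  have h7 : G.Adj b e ∨ G.Adj b f := by
    by_contra! h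
    exact conf_six_indep_four hG (a := a) (b := c) (c := b) (d := d) (e := e) (f := f) hu.reorder
      ead ecb nab nae naf h.1 h.2 h1
  tauto

/-- No vertex of the neighbourhood of a 6-vertex has a single neighbour in it. -/
theorem six_pendant (hG : NoReducible G) (hr : IsRobust G) {u a b c d e f : V}
    (hu : NbrList G u [a, b, c, d, e, f]) (nab : ¬ G.Adj a b)
    (nac : ¬ G.Adj a c) (nae : ¬ G.Adj a e) (naf : ¬ G.Adj a f) : False := by
  obtain ⟨y, hy, h⟩ := hr.exists_common_nbr (hu.adj (x := a) (by simp))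
  have ead : G.Adj a d := by
    grind [hu.2 y, SimpleGraph.irrefl]
  by_cases h1 : G.Adj b c
  · exact six_pendant_aux hG hu ead nab nac nae naf h1
  by_cases h2 : G.Adj b e
  · exact six_pendant_aux hG (b := b) (c := e) (e := c) (f := f) hu.reorder ead nab nae nac naf h2
  by_cases h3 : G.Adj b f
  · exact six_pendant_aux hG (b := b) (c := f) (e := e) (f := c) hu.reorder ead nab naf nae nac h3
  by_cases h4 : G.Adj c e
  · exact six_pendant_aux hG (b := c) (c := e) (e := b) (f := f) hu.reorder ead nac nae nab naf h4
  by_cases h5 : G.Adj c f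
  · exact six_pendant_aux hG (b := c) (c := f) (e := e) (f := b) hu.reorder ead nac naf nae nab h5
  by_cases h6 : G.Adj e f
  · exact six_pendant_aux hG (b := e) (c := f) (e := b) (f := c) hu.reorder ead nae naf nab nac h6
  exact conf_six_indep_five hG hu ead nab nac nae naf h1 h2 h3 h4 h5 h6

theorem six_matching_edge_adj (hG : NoReducible G) (hr : IsRobust G) {u a b c d e f : V}
    (hu : NbrList G u [a, b, c, d, e, f]) (nab : ¬ G.Adj a b) (nac : ¬ G.Adj a c)
    (ead : G.Adj a d) (eae : G.Adj a e) (ebc : G.Adj b c) (eaf : G.Adj a f) : False := by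
  have hs : ∀ {x y}, ¬ G.Adj x y → ¬ G.Adj y x := fun h h' => h h'.symm
  have nfe : ¬ G.Adj f e := fun h => conf_six_three_edges hG hu ead ebc h.symm nab nac
  have nfd : ¬ G.Adj f d := fun h =>
    conf_six_three_edges hG (d := e) (e := d) hu.reorder eae ebc h.symm nab nac
  have nde : ¬ G.Adj d e := fun h =>
    conf_six_three_edges hG (d := f) (e := d) (f := e) hu.reorder eaf ebc h nab nac
  have hd : G.Adj d b ∨ G.Adj d c := by
    by_contra! h
    exact six_pendant hG hr (a := d) (b := b) (c := c) (d := a) (e := e) (f := f) hu.reorder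
      h.1 h.2 nde (hs nfd)
  have he : G.Adj e b ∨ G.Adj e c := by
    by_contra! h
    exact six_pendant hG hr (a := e) (b := b) (c := c) (d := a) (e := d) (f := f) hu.reorder
      h.1 h.2 (hs nde) (hs nfe)
  have hf : G.Adj f b ∨ G.Adj f c := by
    by_contra! h
    exact six_pendant hG hr (a := f) (b := b) (c := c) (d := a) (e := d) (f := e) hu.reorder
      h.1 h.2 nfd nfe
  have hc : G.Adj d c ∨ G.Adj e c ∨ G.Adj f c := by
    by_contra! h
    exact six_pendant hG hr (a := c) (b := a) (c := d) (d := b) (e := e) (f := f) hu.reorder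
      (hs nac) (hs h.1) (hs h.2.1) (hs h.2.2)
  have hb : G.Adj d b ∨ G.Adj e b ∨ G.Adj f b := by
    by_contra! h
    exact six_pendant hG hr (a := b) (b := a) (c := d) (d := c) (e := e) (f := f) hu.reorder
      (hs nab) (hs h.1) (hs h.2.1) (hs h.2.2)
  -- an independent triple `d, e, f` matched with `a, b, c`
  have h1 : ∀ {p q}, NbrList G u [d, e, f, a, p, q] → ¬ (G.Adj e p ∧ G.Adj f q) :=
    fun hl h => conf_six_indep_three_matched hG hl ead.symm h.1 h.2 nde (hs nfd) (hs nfe)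
  have h2 : ∀ {p q}, NbrList G u [d, e, f, p, a, q] → ¬ (G.Adj d p ∧ G.Adj f q) :=
    fun hl h => conf_six_indep_three_matched hG hl h.1 eae.symm h.2 nde (hs nfd) (hs nfe)
  have h3 : ∀ {p q}, NbrList G u [d, e, f, p, q, a] → ¬ (G.Adj d p ∧ G.Adj e q) :=
    fun hl h => conf_six_indep_three_matched hG hl h.1 h.2 eaf.symm nde (hs nfd) (hs nfe)
  have h11 := h1 (p := b) (q := c) hu.reorder
  have h12 := h1 (p := c) (q := b) hu.reorder
  have h21 := h2 (p := b) (q := c) hu.reorder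
  have h22 := h2 (p := c) (q := b) hu.reorder
  have h31 := h3 (p := b) (q := c) hu.reorder
  have h32 := h3 (p := c) (q := b) hu.reorder
  rcases hd with hd | hd
  · have hfb := hf.resolve_right fun h => h21 ⟨hd, h⟩
    have heb := he.resolve_right fun h => h31 ⟨hd, h⟩
    exact hc.elim (fun h => h22 ⟨h, hfb⟩) (·.elim (fun h => h12 ⟨h, hfb⟩) fun h => h11 ⟨heb, h⟩)
  · have hfc := hf.resolve_left fun h => h22 ⟨hd, h⟩
    have hec := he.resolve_left fun h => h32 ⟨hd, h⟩
    exact hb.elim (fun h => h21 ⟨h, hfc⟩) (·.elim (fun h => h11 ⟨h, hfc⟩) fun h => h12 ⟨hec, h⟩)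

theorem six_matching_edge_not_adj (hG : NoReducible G) (hr : IsRobust G) {u a b c d e f : V}
    (hu : NbrList G u [a, b, c, d, e, f]) (nab : ¬ G.Adj a b) (nac : ¬ G.Adj a c)
    (ead : G.Adj a d) (eae : G.Adj a e) (ebc : G.Adj b c) (eaf : ¬ G.Adj a f) : False := by
  have hs : ∀ {x y}, ¬ G.Adj x y → ¬ G.Adj y x := fun h h' => h h'.symm
  have nfe : ¬ G.Adj f e := fun h => conf_six_three_edges hG hu ead ebc h.symm nab nac
  have nfd : ¬ G.Adj f d := fun h =>
    conf_six_three_edges hG (d := e) (e := d) hu.reorder eae ebc h.symm nab nac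
  have efb : G.Adj f b := by
    by_contra h
    exact six_pendant hG hr (a := f) (b := a) (c := b) (d := c) (e := d) (f := e) hu.reorder
      (hs eaf) h nfd nfe
  have efc : G.Adj f c := by
    by_contra h
    exact six_pendant hG hr (a := f) (b := a) (c := c) (d := b) (e := d) (f := e) hu.reorder
      (hs eaf) h nfd nfe
  by_cases ede : G.Adj d e
  · have h1 : ¬ G.Adj e c := fun h => conf_six_three_edges hG (a := f) (b := a) (c := d) (d := b)
      (e := c) (f := e) hu.reorder efb ead h.symm (hs eaf) nfd
    have h2 : ¬ G.Adj e b := fun h => conf_six_three_edges hG (a := f) (b := a) (c := d) (d := c)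
      (e := b) (f := e) hu.reorder efc ead h.symm (hs eaf) nfd
    have h3 : ¬ G.Adj d c := fun h => conf_six_three_edges hG (a := f) (b := a) (c := e) (d := b)
      (e := c) (f := d) hu.reorder efb eae h.symm (hs eaf) nfe
    have h4 : ¬ G.Adj d b := fun h => conf_six_three_edges hG (a := f) (b := a) (c := e) (d := c)
      (e := b) (f := d) hu.reorder efc eae h.symm (hs eaf) nfe
    -- `a, d, e` and `b, c, f` are triangles, and robustness yields an edge between them
    obtain ⟨x, hx, y, hy, huy, hxy⟩ := hr.exists_adj_not_mem (v := u) (l := [a, d, e])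
      (by simp) (by simp) (by simp [hu.2])
    have := (hu.2 y).1 huy
    have hb : y = b ∨ y = c ∨ y = f := by
      simp only [List.mem_cons, List.not_mem_nil, or_false] at hy this; tauto
    have hx' : x = a ∨ x = d ∨ x = e := by simpa using hx
    rcases hx' with rfl | rfl | rfl <;> rcases hb with rfl | rfl | rfl <;>
      first | contradiction | exact hs ‹_› hxy
  · have he : G.Adj e b ∨ G.Adj e c := by
      by_contra! h
      exact six_pendant hG hr (a := e) (b := b) (c := c) (d := a) (e := d) (f := f) hu.reorder
        h.1 h.2 (hs ede) (hs nfe)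
    rcases he with h | h
    · exact conf_six_indep_three_matched hG (a := d) (b := e) (c := f) (d := a) (e := b) (f := c)
        hu.reorder ead.symm h efc ede (hs nfd) (hs nfe)
    · exact conf_six_indep_three_matched hG (a := d) (b := e) (c := f) (d := a) (e := c) (f := b)
        hu.reorder ead.symm h efb ede (hs nfd) (hs nfe)

theorem six_matching_nonedge (hG : NoReducible G) (hr : IsRobust G) {u a b c d e f : V}
    (hu : NbrList G u [a, b, c, d, e, f]) (nab : ¬ G.Adj a b) (nac : ¬ G.Adj a c)
    (ead : G.Adj a d) (eae : G.Adj a e) (ebc : ¬ G.Adj b c) :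
    False := by
  have hs : ∀ {x y}, ¬ G.Adj x y → ¬ G.Adj y x := fun h h' => h h'.symm
  have hb1 : G.Adj b d ∨ G.Adj b e := by
    by_contra! h
    exact six_pendant hG hr (a := b) (b := a) (c := c) (d := f) (e := d) (f := e) hu.reorder
      (hs nab) ebc h.1 h.2
  have hb2 : G.Adj b e ∨ G.Adj b f := by
    by_contra! h
    exact six_pendant hG hr (a := b) (b := a) (c := c) (d := d) (e := e) (f := f) hu.reorder
      (hs nab) ebc h.1 h.2
  have hb3 : G.Adj b d ∨ G.Adj b f := by
    by_contra! h
    exact six_pendant hG hr (a := b) (b := a) (c := c) (d := e) (e := d) (f := f) hu.reorder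
      (hs nab) ebc h.1 h.2
  have hc1 : G.Adj c d ∨ G.Adj c e := by
    by_contra! h
    exact six_pendant hG hr (a := c) (b := a) (c := b) (d := f) (e := d) (f := e) hu.reorder
      (hs nac) (hs ebc) h.1 h.2
  have hc2 : G.Adj c e ∨ G.Adj c f := by
    by_contra! h
    exact six_pendant hG hr (a := c) (b := a) (c := b) (d := d) (e := e) (f := f) hu.reorder
      (hs nac) (hs ebc) h.1 h.2
  have hc3 : G.Adj c d ∨ G.Adj c f := by
    by_contra! h
    exact six_pendant hG hr (a := c) (b := a) (c := b) (d := e) (e := d) (f := f) hu.reorder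
      (hs nac) (hs ebc) h.1 h.2
  have hW : ∀ {x y z}, NbrList G u [a, b, c, x, y, z] →
      ¬ (G.Adj a x ∧ G.Adj b y ∧ G.Adj c z) :=
    fun hl h => conf_six_indep_three_matched hG hl h.1 h.2.1 h.2.2 nab nac ebc
  have w1 := hW (x := d) (y := e) (z := f) hu.reorder
  have w2 := hW (x := d) (y := f) (z := e) hu.reorder
  have w3 := hW (x := e) (y := d) (z := f) hu.reorder
  have w4 := hW (x := e) (y := f) (z := d) hu.reorder
  have w5 := hW (x := f) (y := d) (z := e) hu.reorder
  have w6 := hW (x := f) (y := e) (z := d) hu.reorder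
  have w7 : G.Adj b e → G.Adj a f ∨ G.Adj b f ∨ G.Adj c f := by
    intro ebe
    by_contra! h
    exact conf_six_indep_four_two_edges hG hu ead ebe nab nac h.1 ebc h.2.1 h.2.2
  grind

theorem six_matching_of_adj (hG : NoReducible G) (hr : IsRobust G) {u a b c d e f : V}
    (hu : NbrList G u [a, b, c, d, e, f]) (nab : ¬ G.Adj a b) (nac : ¬ G.Adj a c)
    (ead : G.Adj a d) (eae : G.Adj a e) : False :=
  (em (G.Adj b c)).elim
    (fun ebc => (em (G.Adj a f)).elim (six_matching_edge_adj hG hr hu nab nac ead eae ebc)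
      (six_matching_edge_not_adj hG hr hu nab nac ead eae ebc))
    (six_matching_nonedge hG hr hu nab nac ead eae)

/-- In the neighbourhood of a 6-vertex, no vertex misses two others. -/
theorem six_matching (hG : NoReducible G) (hr : IsRobust G) {u a b c d e f : V}
    (hu : NbrList G u [a, b, c, d, e, f]) (nab : ¬ G.Adj a b) (nac : ¬ G.Adj a c) : False := by
  by_cases ed : G.Adj a d
  · by_cases ee : G.Adj a e
    · exact six_matching_of_adj hG hr hu nab nac ed ee
    by_cases ef : G.Adj a f
    · exact six_matching_of_adj hG hr (e := f) (f := e) hu.reorder nab nac ed ef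
    · exact six_pendant hG hr hu nab nac ee ef
  · by_cases ee : G.Adj a e
    · by_cases ef : G.Adj a f
      · exact six_matching_of_adj hG hr (d := e) (e := f) (f := d) hu.reorder nab nac ee ef
      · exact six_pendant hG hr (d := e) (e := d) (f := f) hu.reorder nab nac ed ef
    · exact six_pendant hG hr (d := f) (e := d) (f := e) hu.reorder nab nac ed ee

/-! ### Low vertices -/

/-- A vertex is low if its degree is 5 or 6. -/
def IsLow (G : SimpleGraph V) (u : V) : Prop :=
  (G.neighborSet u).ncard = 5 ∨ (G.neighborSet u).ncard = 6

theorem exists_nbrList_append_length [Finite V] (v : V) (l : List V) (hl : l.Nodup)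
    (h : ∀ x ∈ l, G.Adj v x) :
    ∃ r, NbrList G v (l ++ r) ∧ l.length + r.length = (G.neighborSet v).ncard := by
  obtain ⟨r, hr⟩ := exists_nbrList_append v l hl h
  exact ⟨r, hr, by rw [hr.ncard, List.length_append]⟩

/-- The non-edges inside the neighbourhood of a low vertex form a matching. -/
theorem IsLow.adj_or_adj [Finite V] (hG : NoReducible G) (hr : IsRobust G) {u x y z : V}
    (hu : IsLow G u) (hx : G.Adj u x) (hy : G.Adj u y) (hz : G.Adj u z) (hxy : x ≠ y)
    (hxz : x ≠ z) (hyz : y ≠ z) : G.Adj x y ∨ G.Adj x z := by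
  by_contra! h
  obtain ⟨r, hl, hlen⟩ := exists_nbrList_append_length (G := G) u [x, y, z]
    (by simp [*]) (by simp [*])
  rcases hu with hu | hu
  · obtain ⟨a, b, rfl⟩ := List.length_eq_two.1 (show r.length = 2 by simp at hlen; omega)
    exact five_matching hG hr hl h.1 h.2
  · obtain ⟨a, b, c, rfl⟩ := List.length_eq_three.1 (show r.length = 3 by simp at hlen; omega)
    exact six_matching hG hr hl h.1 h.2

theorem conf_five_two_nonedges (hG : NoReducible G) {u a b c d e : V}
    (hu : NbrList G u [a, b, c, d, e]) (eac : G.Adj a c) (ead : G.Adj a d) (eae : G.Adj a e)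
    (ebc : G.Adj b c) (ebd : G.Adj b d) (ebe : G.Adj b e) (ece : G.Adj c e) (ede : G.Adj d e)
    (nab : ¬ G.Adj a b) (ncd : ¬ G.Adj c d) : False :=
  hG.false_of_certificate [u, a, b, c, d, e]
    [(0, [1, 2, 3, 4, 5])] [(1, 3), (1, 4), (1, 5), (2, 3), (2, 4), (2, 5), (3, 5), (4, 5)]
    [(1, 2), (3, 4)] [] [(0, 1, 3), (0, 2, 4), (1, 4, 5), (2, 3, 5)]
    [(1, 3), (1, 4), (1, 5), (2, 3), (2, 4), (2, 5), (3, 5), (4, 5)]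

/-- Inside the neighbourhood of a 5-vertex there is at most one non-edge. -/
theorem five_nonadj [Finite V] (hG : NoReducible G) (hr : IsRobust G) {u a b c d e : V}
    (hu : NbrList G u [a, b, c, d, e]) (nab : ¬ G.Adj a b) : G.Adj c d := by
  have hlow : IsLow G u := Or.inl (by rw [hu.ncard]; rfl)
  have hn := hu.1
  have hm := fun x y z hx hy hz => hlow.adj_or_adj hG hr (x := x) (y := y) (z := z) (hu.adj hx)
    (hu.adj hy) (hu.adj hz)
  simp at hn hm
  by_contra ncd
  exact conf_five_two_nonedges hG hu (by grind) (by grind) (by grind)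
    (by grind [SimpleGraph.adj_comm]) (by grind [SimpleGraph.adj_comm])
    (by grind [SimpleGraph.adj_comm]) (by grind [SimpleGraph.adj_comm])
    (by grind [SimpleGraph.adj_comm]) nab ncd

theorem NbrList.perm {v : V} {l l' : List V} (h : NbrList G v l) (hp : l.Perm l') :
    NbrList G v l' :=
  ⟨hp.nodup_iff.1 h.1, fun x => (h.2 x).trans hp.mem_iff⟩

theorem NbrList.isLow {v : V} {l : List V} (h : NbrList G v l)
    (hl : l.length = 5 ∨ l.length = 6 := by simp) : IsLow G v := by
  rwa [IsLow, h.ncard]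

/-- `IsLow.adj_or_adj` for the entries of a list of neighbours. -/
theorem NbrList.adj_or [Finite V] (hG : NoReducible G) (hr : IsRobust G) {v : V} {l : List V}
    (h : NbrList G v l) (i j k : ℕ)
    (hl : l.length = 5 ∨ l.length = 6 := by simp)
    (hi : i < l.length ∧ j < l.length ∧ k < l.length := by simp)
    (hij : i ≠ j ∧ i ≠ k ∧ j ≠ k := by simp) :
    G.Adj (l[i]'hi.1) (l[j]'hi.2.1) ∨ G.Adj (l[i]'hi.1) (l[k]'hi.2.2) := by
  have hne : ∀ {p q : ℕ} (hp : p < l.length) (hq : q < l.length), p ≠ q → l[p] ≠ l[q] :=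
    fun hp hq hpq e => hpq ((h.1.getElem_inj_iff).1 e)
  exact (h.isLow hl).adj_or_adj hG hr (h.adj (List.getElem_mem _)) (h.adj (List.getElem_mem _))
    (h.adj (List.getElem_mem _)) (hne _ _ hij.1) (hne _ _ hij.2.1) (hne _ _ hij.2.2)

/-- Any four neighbours of a low vertex carry a 4-cycle, whose missing diagonals may be chosen
such that `a' b'` is missing as soon as one of them is. -/
theorem IsLow.exists_four_cycle [Finite V] (hG : NoReducible G) (hr : IsRobust G) {u a b c d : V}
    (hu : IsLow G u) (hn : [a, b, c, d].Nodup) (hadj : ∀ x ∈ [a, b, c, d], G.Adj u x) :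
    ∃ a' b' c' d', [a, b, c, d].Perm [a', b', c', d'] ∧ G.Adj a' c' ∧ G.Adj a' d' ∧ G.Adj b' c' ∧
      G.Adj b' d' ∧ (G.Adj a' b' → G.Adj c' d') := by
  have key : ∀ a' b' c' d', [a, b, c, d] ⊆ [a', b', c', d'] →
      ¬ G.Adj a' b' → ∃ a' b' c' d', [a, b, c, d].Perm [a', b', c', d'] ∧ G.Adj a' c' ∧
        G.Adj a' d' ∧ G.Adj b' c' ∧ G.Adj b' d' ∧ (G.Adj a' b' → G.Adj c' d') := by
    intro a' b' c' d' hs h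
    have hp : [a, b, c, d].Perm [a', b', c', d'] := (hn.subperm hs).perm_of_length_le le_rfl
    have hn' := hp.nodup_iff.1 hn
    have ha : ∀ x ∈ [a', b', c', d'], G.Adj u x := fun x hx => hadj x (hp.mem_iff.2 hx)
    simp only [List.mem_cons, List.not_mem_nil, or_false, forall_eq_or_imp, forall_eq] at ha
    simp only [List.nodup_cons, List.mem_cons, List.not_mem_nil, or_false, not_or] at hn'
    obtain ⟨h1, h2, h3, h4⟩ := ha
    obtain ⟨⟨n1, n2, n3⟩, ⟨n4, n5⟩, n6, -⟩ := hn'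
    refine ⟨a', b', c', d', hp,
      (hu.adj_or_adj hG hr h1 h2 h3 n1 n2 n4).resolve_left h,
      (hu.adj_or_adj hG hr h1 h2 h4 n1 n3 n5).resolve_left h,
      (hu.adj_or_adj hG hr h2 h1 h3 (Ne.symm n1) n4 n2).resolve_left fun e => h e.symm,
      (hu.adj_or_adj hG hr h2 h1 h4 (Ne.symm n1) n5 n3).resolve_left fun e => h e.symm,
      fun e => absurd e h⟩
  by_cases h1 : G.Adj a c
  swap
  · exact key a c b d (by simp) h1
  by_cases h2 : G.Adj a d
  swap
  · exact key a d b c (by simp) h2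
  by_cases h3 : G.Adj b c
  swap
  · exact key b c a d (by simp) h3
  by_cases h4 : G.Adj b d
  swap
  · exact key b d a c (by simp) h4
  by_cases h5 : G.Adj a b
  swap
  · exact key a b c d (by simp) h5
  by_cases h6 : G.Adj c d
  swap
  · exact key c d a b (by simp) h6
  exact ⟨a, b, c, d, List.Perm.refl _, h1, h2, h3, h4, fun _ => h6⟩

/-- The common neighbours of a low vertex and one of its neighbours. -/
theorem IsLow.exists_common_list [Finite V] (hG : NoReducible G) (hr : IsRobust G) {u w : V}
    (hu : IsLow G u) (h : G.Adj u w) :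
    ∃ l, (∀ x ∈ l, G.Adj w x) ∧
      (NbrList G u (w :: l) ∨ ∃ d, ¬ G.Adj w d ∧ NbrList G u (w :: (l ++ [d]))) := by
  by_cases hd : ∃ d, G.Adj u d ∧ d ≠ w ∧ ¬ G.Adj w d
  · obtain ⟨d, hud, hdw, hwd⟩ := hd
    obtain ⟨l, hl⟩ := exists_nbrList_append (G := G) u [w, d] (by simp [hdw.symm]) (by simp [*])
    refine ⟨l, fun x hx => ?_, Or.inr ⟨d, hwd, hl.perm ?_⟩⟩
    · have hn := hl.1
      simp only [List.cons_append, List.nil_append, List.nodup_cons, List.mem_cons, not_or] at hn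
      exact (hu.adj_or_adj hG hr h hud (hl.adj (by simp [hx])) hdw.symm
        (fun e => hn.1.2 (e ▸ hx)) (fun e => hn.2.1 (e ▸ hx))).resolve_left hwd
    · exact (List.perm_append_comm (l₁ := [d]) (l₂ := l)).cons w
  · push Not at hd
    obtain ⟨l, hl⟩ := exists_nbrList_append (G := G) u [w] (by simp) (by simp [h])
    refine ⟨l, fun x hx => hd x (hl.adj (by simp [hx])) ?_, Or.inl hl⟩
    rintro rfl
    exact (List.nodup_cons.1 hl.1).1 hx

/-! ### Low vertices are not adjacent -/

/-- Two adjacent 5-vertices with the same closed neighbourhood, which contains a 4-cycle. -/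
theorem conf_adj_five_five_twins (hG : NoReducible G) {u w a b c d : V}
    (hu : NbrList G u [w, a, b, c, d]) (hw : NbrList G w [u, a, b, c, d]) (eac : G.Adj a c)
    (ead : G.Adj a d) (ebc : G.Adj b c) (ebd : G.Adj b d) : False :=
  hG.false_of_certificate [u, w, a, b, c, d]
    [(0, [1, 2, 3, 4, 5]), (1, [0, 2, 3, 4, 5])] [(2, 4), (2, 5), (3, 4), (3, 5)] [] []
    [(0, 2, 4), (0, 3, 5), (1, 2, 5), (1, 3, 4)]
    [(2, 3), (2, 4), (2, 5), (3, 4), (3, 5), (4, 5), (0, 1)]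

theorem conf_adj_five_five (hG : NoReducible G) {u w a b c d e : V}
    (hu : NbrList G u [w, a, b, c, d]) (hw : NbrList G w [u, a, b, c, e]) (eab : G.Adj a b)
    (eac : G.Adj a c) (ebe : G.Adj b e) (ecd : G.Adj c d) (hde : d ≠ e) : False :=
  hG.false_of_certificate [u, w, a, b, c, d, e]
    [(0, [1, 2, 3, 4, 5]), (1, [0, 2, 3, 4, 6])] [(2, 3), (2, 4), (3, 6), (4, 5)] [] [(5, 6)]
    [(0, 2, 3), (0, 4, 5), (1, 2, 4), (1, 3, 6)]
    [(2, 3), (4, 5), (2, 4), (3, 6), (3, 4), (0, 1), (0, 5), (1, 6)]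

/-- An adjacent 5-vertex and 6-vertex, where `w` is adjacent to all other neighbours of `u`. -/
theorem conf_adj_five_six (hG : NoReducible G) {u w a b c d e : V}
    (hu : NbrList G u [w, a, b, c, d]) (hw : NbrList G w [u, a, b, c, d, e]) (eac : G.Adj a c)
    (ead : G.Adj a d) (ebc : G.Adj b c) (ebd : G.Adj b d) : False :=
  hG.false_of_certificate [u, w, a, b, c, d, e]
    [(0, [1, 2, 3, 4, 5]), (1, [0, 2, 3, 4, 5, 6])] [(2, 4), (2, 5), (3, 4), (3, 5)] [] []
    [(0, 2, 4), (0, 3, 5), (1, 2, 5), (1, 3, 4)]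
    [(2, 3), (2, 4), (2, 5), (3, 4), (3, 5), (4, 5), (0, 1), (1, 6)]

/-- Two adjacent 6-vertices with the same closed neighbourhood, which contains a 4-cycle. -/
theorem conf_adj_six_six_twins (hG : NoReducible G) {u w a b c d e : V}
    (hu : NbrList G u [w, a, b, c, d, e]) (hw : NbrList G w [u, a, b, c, d, e]) (eac : G.Adj a c)
    (ead : G.Adj a d) (ebc : G.Adj b c) (ebd : G.Adj b d) : False :=
  hG.false_of_certificate [u, w, a, b, c, d, e]
    [(0, [1, 2, 3, 4, 5, 6]), (1, [0, 2, 3, 4, 5, 6])] [(2, 4), (2, 5), (3, 4), (3, 5)] [] []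
    [(0, 2, 4), (0, 3, 5), (1, 2, 5), (1, 3, 4), (0, 1, 6)]
    [(2, 3), (2, 4), (2, 5), (3, 4), (3, 5), (4, 5), (0, 1), (0, 6), (1, 6)]

theorem conf_adj_six_six (hG : NoReducible G) {u w a b c d e f : V}
    (hu : NbrList G u [w, a, b, c, d, e]) (hw : NbrList G w [u, a, b, c, d, f]) (eac : G.Adj a c)
    (ead : G.Adj a d) (ece : G.Adj c e) (edf : G.Adj d f) (nuf : ¬ G.Adj u f) : False :=
  hG.false_of_certificate [u, w, a, b, c, d, e, f]
    [(0, [1, 2, 3, 4, 5, 6]), (1, [0, 2, 3, 4, 5, 7])] [(2, 4), (2, 5), (4, 6), (5, 7)] [(0, 7)] []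
    [(1, 2, 4), (0, 2, 5), (0, 1, 3), (0, 4, 6), (1, 5, 7)]
    [(2, 4), (2, 5), (1, 2), (0, 3), (1, 3), (4, 6), (1, 4), (5, 7), (0, 5), (0, 6)]

theorem NbrList.not_adj_of_mem {u w d x : V} {l s : List V} (hN : NbrList G u (w :: (l ++ [d])))
    (hs : NbrList G w (u :: l ++ s)) (hd : ¬ G.Adj w d) (hx : x ∈ s) : ¬ G.Adj u x := by
  have hwx : G.Adj w x := hs.adj (by simp [hx])
  have hn := (List.nodup_append.1 hs.1).2.2
  rw [hN.2]
  simp only [List.mem_cons, List.mem_append, List.not_mem_nil, or_false]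
  rintro (rfl | h | rfl)
  · exact G.irrefl hwx
  · exact hn x (List.mem_cons_of_mem _ h) x hx rfl
  · exact hd hwx

theorem not_adj_five_low [Finite V] (hG : NoReducible G) (hr : IsRobust G) {u w : V}
    (hu : (G.neighborSet u).ncard = 5) (hw : IsLow G w) : ¬ G.Adj u w := by
  intro h
  have hlu : IsLow G u := Or.inl hu
  obtain ⟨l, hl, hN | ⟨d, hd, hN⟩⟩ := hlu.exists_common_list hG hr h
  · obtain ⟨s, hs, hlen⟩ := exists_nbrList_append_length (G := G) w (u :: l)
      (List.nodup_cons.2 ⟨fun hx => G.irrefl (hN.adj (by simp [hx])), (List.nodup_cons.1 hN.1).2⟩)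
      (by simpa [h.symm] using hl)
    rw [hN.ncard] at hu
    obtain ⟨a, b, c, d, rfl⟩ := List.length_eq_four.1 (show l.length = 4 by simpa using hu)
    obtain ⟨a', b', c', d', hp, h1, h2, h3, h4, -⟩ := hlu.exists_four_cycle hG hr
      (List.nodup_cons.1 hN.1).2 (fun x hx => hN.adj (List.mem_cons_of_mem _ hx))
    have hN' := hN.perm (hp.cons w)
    have hs' := hs.perm ((hp.cons u).append_right s)
    rcases hw with hw | hw
    · obtain rfl := List.length_eq_zero_iff.1 (show s.length = 0 by simp at hlen; omega)
      exact conf_adj_five_five_twins hG hN' hs' h1 h2 h3 h4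
    · obtain ⟨e, rfl⟩ := List.length_eq_one_iff.1 (show s.length = 1 by simp at hlen; omega)
      exact conf_adj_five_six hG hN' hs' h1 h2 h3 h4
  · obtain ⟨s, hs, hlen⟩ := exists_nbrList_append_length (G := G) w (u :: l)
      (List.nodup_cons.2 ⟨fun hx => G.irrefl (hN.adj (by simp [hx])),
        ((List.nodup_cons.1 hN.1).2).of_append_left⟩)
      (by simpa [h.symm] using hl)
    rw [hN.ncard] at hu
    obtain ⟨a, b, c, rfl⟩ := List.length_eq_three.1 (show l.length = 3 by simpa using hu)
    rcases hw with hw | hw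
    · obtain ⟨e, rfl⟩ := List.length_eq_one_iff.1 (show s.length = 1 by simp at hlen; omega)
      have hnue : ¬ G.Adj u e := hN.not_adj_of_mem hs hd (by simp)
      have hde : d ≠ e := by rintro rfl; exact hd (hs.adj (by simp))
      have da : G.Adj d a := (hN.adj_or hG hr 4 0 1).resolve_left fun h => hd h.symm
      have db : G.Adj d b := (hN.adj_or hG hr 4 0 2).resolve_left fun h => hd h.symm
      have dc : G.Adj d c := (hN.adj_or hG hr 4 0 3).resolve_left fun h => hd h.symm
      have ea : G.Adj e a := (hs.adj_or hG hr 4 0 1).resolve_left fun h => hnue h.symm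
      have eb : G.Adj e b := (hs.adj_or hG hr 4 0 2).resolve_left fun h => hnue h.symm
      have ec : G.Adj e c := (hs.adj_or hG hr 4 0 3).resolve_left fun h => hnue h.symm
      by_cases hab : G.Adj a b
      · by_cases hac : G.Adj a c
        · exact conf_adj_five_five hG hN hs hab hac eb.symm dc.symm hde
        · have hbc : G.Adj c b := (hN.adj_or hG hr 3 1 2).resolve_left fun h => hac h.symm
          exact conf_adj_five_five hG (a := b) (b := a) (c := c) hN.reorder hs.reorder hab.symm
            hbc.symm ea.symm dc.symm hde
      · have hac : G.Adj a c := (hN.adj_or hG hr 1 2 3).resolve_left hab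
        have hbc : G.Adj b c := (hN.adj_or hG hr 2 1 3).resolve_left fun h => hab h.symm
        exact conf_adj_five_five hG (a := c) (b := a) (c := b) hN.reorder hs.reorder hac.symm
          hbc.symm ea.symm db.symm hde
    · obtain ⟨e, f, rfl⟩ := List.length_eq_two.1 (show s.length = 2 by simp at hlen; omega)
      rcases (hs.adj_or hG hr 0 4 5 : G.Adj u e ∨ G.Adj u f) with h' | h'
      · exact hN.not_adj_of_mem hs hd (by simp) h'
      · exact hN.not_adj_of_mem hs hd (by simp) h'

/-- Low vertices are never adjacent. -/
theorem IsLow.not_adj [Finite V] (hG : NoReducible G) (hr : IsRobust G) {u w : V}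
    (hu : IsLow G u) (hw : IsLow G w) : ¬ G.Adj u w := by
  rcases hu with hu5 | hu6
  · exact not_adj_five_low hG hr hu5 hw
  rcases hw with hw5 | hw6
  · exact fun h => not_adj_five_low hG hr hw5 (Or.inr hu6) h.symm
  intro h
  have hlu : IsLow G u := Or.inr hu6
  obtain ⟨l, hl, hN | ⟨e, he, hN⟩⟩ := hlu.exists_common_list hG hr h
  · obtain ⟨s, hs, hlen⟩ := exists_nbrList_append_length (G := G) w (u :: l)
      (List.nodup_cons.2 ⟨fun hx => G.irrefl (hN.adj (by simp [hx])), (List.nodup_cons.1 hN.1).2⟩)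
      (by simpa [h.symm] using hl)
    have hl5 : l.length = 5 := by have := hN.ncard; simp at this; omega
    obtain rfl := List.length_eq_zero_iff.1 (show s.length = 0 by simp at hlen; omega)
    obtain ⟨a, l, rfl⟩ := List.exists_of_length_succ l hl5
    obtain ⟨b, c, d, e, rfl⟩ := List.length_eq_four.1 (show l.length = 4 by simpa using hl5)
    obtain ⟨b', c', d', e', hp, h1, h2, h3, h4, -⟩ := hlu.exists_four_cycle hG hr
      (a := b) (b := c) (c := d) (d := e)
      (List.nodup_cons.1 (List.nodup_cons.1 hN.1).2).2 (fun x hx => hN.adj (by simp at hx ⊢; tauto))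
    have hp' : (a :: [b, c, d, e]).Perm ([b', c', d', e'] ++ [a]) :=
      (hp.cons a).trans (List.perm_append_comm (l₁ := [a]))
    exact conf_adj_six_six_twins hG (hN.perm (hp'.cons w)) (hs.perm ((hp'.cons u).append_right []))
      h1 h2 h3 h4
  · obtain ⟨s, hs, hlen⟩ := exists_nbrList_append_length (G := G) w (u :: l)
      (List.nodup_cons.2 ⟨fun hx => G.irrefl (hN.adj (by simp [hx])),
        ((List.nodup_cons.1 hN.1).2).of_append_left⟩)
      (by simpa [h.symm] using hl)
    have hl4 : l.length = 4 := by have := hN.ncard; simp at this; omega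
    obtain ⟨a, b, c, d, rfl⟩ := List.length_eq_four.1 hl4
    obtain ⟨f, rfl⟩ := List.length_eq_one_iff.1 (show s.length = 1 by simp at hlen; omega)
    obtain ⟨a', b', c', d', hp, h1, h2, h3, h4, -⟩ := hlu.exists_four_cycle hG hr
      (a := a) (b := b) (c := c) (d := d) (List.nodup_cons.1 hN.1).2.of_append_left
      (fun x hx => hN.adj (by simp at hx ⊢; tauto))
    have hN' := hN.perm ((hp.append_right [e]).cons w)
    have hs' := hs.perm ((hp.append_right [f]).cons u)
    have hnuf : ¬ G.Adj u f := hN.not_adj_of_mem hs he (by simp)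
    have ec : G.Adj e c' := (hN'.adj_or hG hr 5 0 3).resolve_left fun h => he h.symm
    have fd : G.Adj f d' := (hs'.adj_or hG hr 5 0 4).resolve_left fun h => hnuf h.symm
    exact conf_adj_six_six hG hN' hs' h1 h2 ec.symm fd.symm hnuf

/-! ### Common neighbours of low vertices -/

/-- Common neighbours carrying the 4-cycle `a c b d`; `e` and `f` may coincide. -/
theorem conf_common_five_five (hG : NoReducible G) {u w a b c d e f : V}
    (hu : NbrList G u [a, b, c, d, e]) (hw : NbrList G w [a, b, c, d, f]) (eac : G.Adj a c)
    (ead : G.Adj a d) (ebc : G.Adj b c) (ebd : G.Adj b d) (nuw : ¬ G.Adj u w) (huw : u ≠ w)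
    : False :=
  hG.false_of_certificate [u, w, a, b, c, d, e, f]
    [(0, [2, 3, 4, 5, 6]), (1, [2, 3, 4, 5, 7])] [(2, 4), (2, 5), (3, 4), (3, 5)] [(0, 1)] [(0, 1)]
    [(0, 2, 4), (0, 3, 5), (1, 2, 5), (1, 3, 4)]
    [(2, 3), (2, 4), (2, 5), (3, 4), (3, 5), (4, 5), (0, 6), (1, 7)]

theorem conf_common_five_six_edge (hG : NoReducible G) {u w a b c d e x y : V}
    (hu : NbrList G u [a, b, c, d, e]) (hw : NbrList G w [a, b, c, d, x, y]) (eac : G.Adj a c)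
    (ead : G.Adj a d) (ebc : G.Adj b c) (ebd : G.Adj b d) (exy : G.Adj x y) (nuw : ¬ G.Adj u w)
    (huw : u ≠ w) : False :=
  hG.false_of_certificate [u, w, a, b, c, d, e, x, y]
    [(0, [2, 3, 4, 5, 6]), (1, [2, 3, 4, 5, 7, 8])] [(2, 4), (2, 5), (3, 4), (3, 5), (7, 8)]
    [(0, 1)] [(0, 1)] [(0, 2, 4), (0, 3, 5), (1, 2, 5), (1, 3, 4), (1, 7, 8)]
    [(2, 3), (2, 4), (2, 5), (3, 4), (3, 5), (4, 5), (0, 6), (1, 7), (1, 8), (7, 8)]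

theorem conf_common_five_six_nonedge (hG : NoReducible G) {u w a b c d e x y : V}
    (hu : NbrList G u [a, b, c, d, e]) (hw : NbrList G w [a, b, c, d, x, y]) (eac : G.Adj a c)
    (ead : G.Adj a d) (ebc : G.Adj b c) (ebd : G.Adj b d) (nab : ¬ G.Adj a b) (nuw : ¬ G.Adj u w)
    (huw : u ≠ w) : False :=
  hG.false_of_certificate [u, w, a, b, c, d, e, x, y]
    [(0, [2, 3, 4, 5, 6]), (1, [2, 3, 4, 5, 7, 8])] [(2, 4), (2, 5), (3, 4), (3, 5)]
    [(2, 3), (0, 1)] [(0, 1)] [(0, 2, 4), (0, 3, 5), (1, 2, 5), (1, 3, 4)]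
    [(2, 4), (2, 5), (3, 4), (3, 5), (4, 5), (0, 6), (1, 7), (1, 8)]

theorem conf_common_five_six_clique (hG : NoReducible G) {u w a b c d e x y : V}
    (hu : NbrList G u [a, b, c, d, e]) (hw : NbrList G w [a, b, c, d, x, y]) (eab : G.Adj a b)
    (eac : G.Adj a c) (ead : G.Adj a d) (eax : G.Adj a x) (ebc : G.Adj b c) (ebd : G.Adj b d)
    (ebx : G.Adj b x) (ecd : G.Adj c d) (ecx : G.Adj c x) (edx : G.Adj d x) (nxy : ¬ G.Adj x y)
    (nuw : ¬ G.Adj u w) (huw : u ≠ w) : False :=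
  hG.false_of_certificate [u, w, a, b, c, d, e, x, y]
    [(0, [2, 3, 4, 5, 6]), (1, [2, 3, 4, 5, 7, 8])]
    [(2, 3), (2, 4), (2, 5), (2, 7), (3, 4), (3, 5), (3, 7), (4, 5), (4, 7), (5, 7)]
    [(7, 8), (0, 1)] [(0, 1)] [(0, 2, 4), (0, 3, 5), (1, 2, 5), (1, 3, 4), (2, 3, 7), (4, 5, 7)]
    [(2, 3), (2, 4), (2, 5), (3, 4), (3, 5), (4, 5), (2, 7), (3, 7), (4, 7), (5, 7), (1, 8),
     (0, 6)]

theorem conf_common_six_six_edges (hG : NoReducible G) {u w a b c d e f x y : V}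
    (hu : NbrList G u [a, b, c, d, e, f]) (hw : NbrList G w [a, b, c, d, x, y]) (eac : G.Adj a c)
    (ead : G.Adj a d) (ebc : G.Adj b c) (ebd : G.Adj b d) (eef : G.Adj e f) (exy : G.Adj x y)
    (nuw : ¬ G.Adj u w) (huw : u ≠ w) (hex : e ≠ x) (hey : e ≠ y) (hfx : f ≠ x) (hfy : f ≠ y)
    : False :=
  hG.false_of_certificate [u, w, a, b, c, d, e, f, x, y]
    [(0, [2, 3, 4, 5, 6, 7]), (1, [2, 3, 4, 5, 8, 9])]
    [(2, 4), (2, 5), (3, 4), (3, 5), (6, 7), (8, 9)] [(0, 1)]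
    [(0, 1), (6, 8), (6, 9), (7, 8), (7, 9)]
    [(0, 2, 4), (0, 3, 5), (1, 2, 5), (1, 3, 4), (1, 8, 9), (0, 6, 7)]
    [(2, 3), (2, 4), (2, 5), (3, 4), (3, 5), (4, 5), (0, 6), (0, 7), (6, 7), (1, 8), (1, 9),
     (8, 9)]

/-- Five common neighbours that form a clique. -/
theorem conf_common_six_six_clique_five (hG : NoReducible G) {u w a b c d e f y : V}
    (hu : NbrList G u [a, b, c, d, e, f]) (hw : NbrList G w [a, b, c, d, e, y]) (eab : G.Adj a b)
    (eac : G.Adj a c) (ead : G.Adj a d) (eae : G.Adj a e) (ebc : G.Adj b c) (ebd : G.Adj b d)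
    (ebe : G.Adj b e) (ecd : G.Adj c d) (ece : G.Adj c e) (ede : G.Adj d e) (nuw : ¬ G.Adj u w)
    (huw : u ≠ w) : False :=
  hG.false_of_certificate [u, w, a, b, c, d, e, f, y]
    [(0, [2, 3, 4, 5, 6, 7]), (1, [2, 3, 4, 5, 6, 8])]
    [(2, 3), (2, 4), (2, 5), (2, 6), (3, 4), (3, 5), (3, 6), (4, 5), (4, 6), (5, 6)] [(0, 1)]
    [(0, 1)] [(0, 2, 4), (0, 3, 5), (1, 2, 5), (1, 3, 4), (2, 3, 6), (4, 5, 6)]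
    [(2, 3), (2, 4), (2, 5), (3, 4), (3, 5), (4, 5), (2, 6), (3, 6), (4, 6), (5, 6), (1, 8),
     (0, 7)]

theorem conf_common_six_six_nonedge (hG : NoReducible G) {u w a b c d e f x y : V}
    (hu : NbrList G u [a, b, c, d, e, f]) (hw : NbrList G w [a, b, c, d, x, y]) (eac : G.Adj a c)
    (ead : G.Adj a d) (ebc : G.Adj b c) (ebd : G.Adj b d) (eef : G.Adj e f) (nab : ¬ G.Adj a b)
    (nuw : ¬ G.Adj u w) (huw : u ≠ w) : False :=
  hG.false_of_certificate [u, w, a, b, c, d, e, f, x, y]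
    [(0, [2, 3, 4, 5, 6, 7]), (1, [2, 3, 4, 5, 8, 9])] [(2, 4), (2, 5), (3, 4), (3, 5), (6, 7)]
    [(2, 3), (0, 1)] [(0, 1)] [(0, 2, 4), (0, 3, 5), (1, 2, 5), (1, 3, 4), (0, 6, 7)]
    [(2, 4), (2, 5), (3, 4), (3, 5), (4, 5), (6, 7), (0, 6), (0, 7), (1, 8), (1, 9)]

theorem conf_common_six_six_clique (hG : NoReducible G) {u w a b c d e f x y : V}
    (hu : NbrList G u [a, b, c, d, e, f]) (hw : NbrList G w [a, b, c, d, x, y]) (eab : G.Adj a b)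
    (eac : G.Adj a c) (ead : G.Adj a d) (eax : G.Adj a x) (ebc : G.Adj b c) (ebd : G.Adj b d)
    (ebx : G.Adj b x) (ecd : G.Adj c d) (ecx : G.Adj c x) (edx : G.Adj d x) (eef : G.Adj e f)
    (nxy : ¬ G.Adj x y) (nuw : ¬ G.Adj u w) (huw : u ≠ w) (hex : e ≠ x) (hfx : f ≠ x) : False :=
  hG.false_of_certificate [u, w, a, b, c, d, e, f, x, y]
    [(0, [2, 3, 4, 5, 6, 7]), (1, [2, 3, 4, 5, 8, 9])]
    [(2, 3), (2, 4), (2, 5), (2, 8), (3, 4), (3, 5), (3, 8), (4, 5), (4, 8), (5, 8), (6, 7)]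
    [(8, 9), (0, 1)] [(0, 1), (6, 8), (7, 8)]
    [(0, 2, 4), (0, 3, 5), (1, 2, 5), (1, 3, 4), (0, 6, 7), (2, 3, 8), (4, 5, 8)]
    [(2, 3), (2, 4), (2, 5), (3, 4), (3, 5), (4, 5), (2, 8), (3, 8), (4, 8), (5, 8), (1, 9),
     (0, 6), (0, 7), (6, 7)]

theorem conf_common_six_six_two_nonedges (hG : NoReducible G) {u w a b c d e f x y : V}
    (hu : NbrList G u [a, b, c, d, e, f]) (hw : NbrList G w [a, b, c, d, x, y]) (eac : G.Adj a c)
    (ead : G.Adj a d) (ebc : G.Adj b c) (ebd : G.Adj b d) (nab : ¬ G.Adj a b) (ncd : ¬ G.Adj c d)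
    (nuw : ¬ G.Adj u w) (huw : u ≠ w) : False :=
  hG.false_of_certificate [u, w, a, b, c, d, e, f, x, y]
    [(0, [2, 3, 4, 5, 6, 7]), (1, [2, 3, 4, 5, 8, 9])] [(2, 4), (2, 5), (3, 4), (3, 5)]
    [(2, 3), (4, 5), (0, 1)] [(0, 1)] [(0, 2, 4), (0, 3, 5), (1, 2, 5), (1, 3, 4)]
    [(2, 4), (2, 5), (3, 4), (3, 5), (0, 6), (0, 7), (1, 8), (1, 9)]

theorem conf_common_six_six_no_edges (hG : NoReducible G) {u w a b c d e f x y : V}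
    (hu : NbrList G u [a, b, c, d, e, f]) (hw : NbrList G w [a, b, c, d, x, y]) (eac : G.Adj a c)
    (ead : G.Adj a d) (eae : G.Adj a e) (eax : G.Adj a x) (ebc : G.Adj b c) (ebd : G.Adj b d)
    (ecd : G.Adj c d) (ecf : G.Adj c f) (edy : G.Adj d y) (nef : ¬ G.Adj e f) (nxy : ¬ G.Adj x y)
    (nuw : ¬ G.Adj u w) (huw : u ≠ w) (hex : e ≠ x) (hey : e ≠ y) (hfx : f ≠ x) (hfy : f ≠ y)
    : False :=
  hG.false_of_certificate [u, w, a, b, c, d, e, f, x, y]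
    [(0, [2, 3, 4, 5, 6, 7]), (1, [2, 3, 4, 5, 8, 9])]
    [(2, 4), (2, 5), (2, 6), (2, 8), (3, 4), (3, 5), (4, 5), (4, 7), (5, 9)]
    [(6, 7), (8, 9), (0, 1)] [(0, 1), (6, 8), (6, 9), (7, 8), (7, 9)]
    [(2, 4, 5), (1, 2, 8), (0, 2, 6), (1, 3, 4), (0, 3, 5), (0, 4, 7), (1, 5, 9)]
    [(2, 3), (2, 4), (2, 5), (2, 8), (2, 6), (3, 4), (3, 5), (4, 5), (4, 7), (5, 9), (1, 8),
     (1, 9), (0, 6), (0, 7)]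

/-- The case of two nonadjacent 6-vertices whose common neighbours include `a, b, c, d` with `a` and
`b` nonadjacent. -/
theorem six_six_of_not_adj [Finite V] (hG : NoReducible G) (hr : IsRobust G)
    {u w a b c d e f x y : V} (huw : u ≠ w) (nuw : ¬ G.Adj u w)
    (hu : NbrList G u [a, b, c, d, e, f]) (hw : NbrList G w [a, b, c, d, x, y])
    (nab : ¬ G.Adj a b) : False := by
  have nba : ¬ G.Adj b a := fun h => nab h.symm
  have ac : G.Adj a c := (hu.adj_or hG hr 0 1 2).resolve_left nab
  have ad : G.Adj a d := (hu.adj_or hG hr 0 1 3).resolve_left nab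
  have bc : G.Adj b c := (hu.adj_or hG hr 1 0 2).resolve_left nba
  have bd : G.Adj b d := (hu.adj_or hG hr 1 0 3).resolve_left nba
  have nwu : ¬ G.Adj w u := fun h => nuw h.symm
  by_cases ef : G.Adj e f
  · exact conf_common_six_six_nonedge hG hu hw ac ad bc bd ef nab nuw huw
  by_cases xy : G.Adj x y
  · exact conf_common_six_six_nonedge hG hw hu ac ad bc bd xy nab nwu huw.symm
  by_cases cd : G.Adj c d
  swap
  · exact conf_common_six_six_two_nonedges hG hu hw ac ad bc bd nab cd nuw huw
  have nfe : ¬ G.Adj f e := fun h => ef h.symm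
  have nyx : ¬ G.Adj y x := fun h => xy h.symm
  -- a fifth common neighbour takes the place of `d`
  have key : ∀ {e f x y}, NbrList G u [a, b, c, d, e, f] → NbrList G w [a, b, c, d, x, y] →
      ¬ G.Adj e f → e ≠ x := by
    rintro e f _ y hu hw ef rfl
    have nfe : ¬ G.Adj f e := fun h => ef h.symm
    exact conf_common_six_six_nonedge hG (a := a) (b := b) (c := c) (d := e) (e := d) (f := f)
      (x := d) (y := y) hu.reorder hw.reorder ac ((hu.adj_or hG hr 4 5 0).resolve_left ef).symm bc
      ((hu.adj_or hG hr 4 5 1).resolve_left ef).symm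
      ((hu.adj_or hG hr 5 4 3).resolve_left nfe).symm nab nuw huw
  exact conf_common_six_six_no_edges hG hu hw ac ad ((hu.adj_or hG hr 4 5 0).resolve_left ef).symm
    ((hw.adj_or hG hr 4 5 0).resolve_left xy).symm bc bd cd
    ((hu.adj_or hG hr 5 4 2).resolve_left nfe).symm
    ((hw.adj_or hG hr 5 4 3).resolve_left nyx).symm ef xy nuw huw
    (key hu hw ef) (key (x := y) (y := x) hu hw.reorder ef)
    (key (e := f) (f := e) hu.reorder hw nfe)
    (key (e := f) (f := e) (x := y) (y := x) hu.reorder hw.reorder nfe)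

theorem six_six [Finite V] (hG : NoReducible G) (hr : IsRobust G)
    {u w a b c d e f x y : V} (huw : u ≠ w) (nuw : ¬ G.Adj u w)
    (hu : NbrList G u [a, b, c, d, e, f]) (hw : NbrList G w [a, b, c, d, x, y]) : False := by
  have main := fun {a b c d e f x y} => six_six_of_not_adj (a := a) (b := b) (c := c) (d := d)
    (e := e) (f := f) (x := x) (y := y) hG hr huw nuw
  have nwu : ¬ G.Adj w u := fun h => nuw h.symm
  have ab : G.Adj a b := by
    by_contra h; exact main hu hw h
  have ac : G.Adj a c := by
    by_contra h; exact main (a := a) (b := c) (c := b) hu.reorder hw.reorder h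
  have ad : G.Adj a d := by
    by_contra h; exact main (a := a) (b := d) (c := b) (d := c) hu.reorder hw.reorder h
  have bc : G.Adj b c := by
    by_contra h; exact main (a := b) (b := c) (c := a) hu.reorder hw.reorder h
  have bd : G.Adj b d := by
    by_contra h; exact main (a := b) (b := d) (c := a) (d := c) hu.reorder hw.reorder h
  have cd : G.Adj c d := by
    by_contra h; exact main (a := c) (b := d) (c := a) (d := b) hu.reorder hw.reorder h
  -- there is no fifth common neighbour
  have key : ∀ {e f x y}, NbrList G u [a, b, c, d, e, f] → NbrList G w [a, b, c, d, x, y] →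
      e ≠ x := by
    rintro e f _ y hu hw rfl
    have ae : G.Adj a e := by
      by_contra h
      exact main (a := a) (b := e) (c := b) (d := c) (e := d) (x := d) hu.reorder hw.reorder h
    have be : G.Adj b e := by
      by_contra h
      exact main (a := b) (b := e) (c := a) (d := c) (e := d) (x := d) hu.reorder hw.reorder h
    have ce : G.Adj c e := by
      by_contra h
      exact main (a := c) (b := e) (c := a) (d := b) (e := d) (x := d) hu.reorder hw.reorder h
    have de : G.Adj d e := by
      by_contra h
      exact main (a := d) (b := e) (c := a) (d := b) (e := c) (x := c) hu.reorder hw.reorder h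
    exact conf_common_six_six_clique_five hG hu hw ab ac ad ae bc bd be cd ce de nuw huw
  have hex := key hu hw
  have hey := key (x := y) (y := x) hu hw.reorder
  have hfx := key (e := f) (f := e) hu.reorder hw
  have hfy := key (e := f) (f := e) (x := y) (y := x) hu.reorder hw.reorder
  by_cases ef : G.Adj e f
  · by_cases xy : G.Adj x y
    · exact conf_common_six_six_edges hG hu hw ac ad bc bd ef xy nuw huw hex hey hfx hfy
    · have hx := fun i hi hij => (hw.adj_or hG hr 4 5 i (by simp) hi hij).resolve_left xy
      exact conf_common_six_six_clique hG hu hw ab ac ad (hx 0 (by simp) (by simp)).symm bc bd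
        (hx 1 (by simp) (by simp)).symm cd (hx 2 (by simp) (by simp)).symm
        (hx 3 (by simp) (by simp)).symm ef xy nuw huw hex hfx
  · by_cases xy : G.Adj x y
    · have he := fun i hi hij => (hu.adj_or hG hr 4 5 i (by simp) hi hij).resolve_left ef
      exact conf_common_six_six_clique hG hw hu ab ac ad (he 0 (by simp) (by simp)).symm bc bd
        (he 1 (by simp) (by simp)).symm cd (he 2 (by simp) (by simp)).symm
        (he 3 (by simp) (by simp)).symm xy ef nwu huw.symm hex.symm hey.symm
    · exact conf_common_six_six_no_edges hG hu hw ac ad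
        ((hu.adj_or hG hr 4 5 0).resolve_left ef).symm
        ((hw.adj_or hG hr 4 5 0).resolve_left xy).symm bc bd cd
        ((hu.adj_or hG hr 5 4 2).resolve_left fun h => ef h.symm).symm
        ((hw.adj_or hG hr 5 4 3).resolve_left fun h => xy h.symm).symm ef xy nuw huw hex hey hfx
        hfy

theorem five_low_common [Finite V] (hG : NoReducible G) (hr : IsRobust G)
    {u w a b c d e : V} {l : List V} (huw : u ≠ w) (nuw : ¬ G.Adj u w)
    (hu : NbrList G u [a, b, c, d, e]) (hw : NbrList G w ([a, b, c, d] ++ l)) (hlow : IsLow G w) :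
    False := by
  obtain ⟨a', b', c', d', hp, ac, ad, bc, bd, h⟩ := hu.isLow.exists_four_cycle hG hr
    (a := a) (b := b) (c := c) (d := d) (List.Nodup.of_append_left (l₂ := [e]) hu.1)
    (fun x hx => hu.adj (List.mem_append_left [e] hx))
  replace hu : NbrList G u [a', b', c', d', e] := hu.perm (hp.append_right [e])
  replace hw := hw.perm (hp.append_right l)
  have hlen := hw.ncard
  simp only [List.length_append, List.length_cons, List.length_nil] at hlen
  rcases hlow with h5 | h6
  · obtain ⟨f, rfl⟩ := List.length_eq_one_iff.1 (show l.length = 1 by omega)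
    exact conf_common_five_five hG hu hw ac ad bc bd nuw huw
  · obtain ⟨x, y, rfl⟩ := List.length_eq_two.1 (show l.length = 2 by omega)
    by_cases xy : G.Adj x y
    · exact conf_common_five_six_edge hG hu hw ac ad bc bd xy nuw huw
    by_cases ab : G.Adj a' b'
    · have hx := fun i hi hij => (hw.adj_or hG hr 4 5 i (by simp) hi hij).resolve_left xy
      exact conf_common_five_six_clique hG hu hw ab ac ad (hx 0 (by simp) (by simp)).symm bc bd
        (hx 1 (by simp) (by simp)).symm (h ab) (hx 2 (by simp) (by simp)).symm
        (hx 3 (by simp) (by simp)).symm xy nuw huw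
    · exact conf_common_five_six_nonedge hG hu hw ac ad bc bd ab nuw huw

/-- Two low vertices have at most three common neighbours. -/
theorem IsLow.false_of_four_common [Finite V] (hG : NoReducible G) (hr : IsRobust G)
    {u w a b c d : V} (hu : IsLow G u) (hw : IsLow G w) (huw : u ≠ w)
    (hn : [a, b, c, d].Nodup) (hua : ∀ x ∈ [a, b, c, d], G.Adj u x)
    (hwa : ∀ x ∈ [a, b, c, d], G.Adj w x) : False := by
  have nuw := hu.not_adj hG hr hw
  obtain ⟨l, hl, hll⟩ := exists_nbrList_append_length u _ hn hua
  obtain ⟨m, hm, hmm⟩ := exists_nbrList_append_length w _ hn hwa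
  simp only [List.length_cons, List.length_nil] at hll hmm
  rcases hu with hu | hu
  · obtain ⟨e, rfl⟩ := List.length_eq_one_iff.1 (show l.length = 1 by omega)
    exact five_low_common hG hr huw nuw hl hm hw
  obtain ⟨e, f, rfl⟩ := List.length_eq_two.1 (show l.length = 2 by omega)
  rcases hw with hw | hw
  · obtain ⟨e, rfl⟩ := List.length_eq_one_iff.1 (show m.length = 1 by omega)
    exact five_low_common hG hr huw.symm (fun h => nuw h.symm) hm hl (Or.inr hu)
  · obtain ⟨x, y, rfl⟩ := List.length_eq_two.1 (show m.length = 2 by omega)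
    exact six_six hG hr huw nuw hl hm

theorem conf_three_common_five_edge (hG : NoReducible G) {u w v a b c d x y : V}
    (hu : NbrList G u [v, a, b, c, d]) (hw : NbrList G w [v, a, b, x, y]) (eva : G.Adj v a)
    (evb : G.Adj v b) (eab : G.Adj a b) (ead : G.Adj a d) (eax : G.Adj a x) (ebd : G.Adj b d)
    (ecd : G.Adj c d) (nvd : ¬ G.Adj v d) (nuw : ¬ G.Adj u w) (huw : u ≠ w) (hcx : c ≠ x)
    (hdx : d ≠ x) : False :=
  hG.false_of_certificate [u, w, v, a, b, c, d, x, y]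
    [(0, [2, 3, 4, 5, 6]), (1, [2, 3, 4, 7, 8])]
    [(2, 3), (2, 4), (3, 4), (3, 6), (3, 7), (4, 6), (5, 6)] [(2, 6), (0, 1)]
    [(0, 1), (5, 7), (6, 7)] [(3, 4, 6), (1, 3, 7), (0, 2, 3), (1, 2, 4), (0, 5, 6)]
    [(3, 4), (3, 7), (3, 6), (2, 3), (4, 6), (2, 4), (5, 6), (0, 5), (1, 7), (1, 8)]

theorem conf_three_common_five_nonedge (hG : NoReducible G) {u w v a b c d x y : V}
    (hu : NbrList G u [v, a, b, c, d]) (hw : NbrList G w [v, a, b, x, y]) (eva : G.Adj v a)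
    (evb : G.Adj v b) (eax : G.Adj a x) (ebd : G.Adj b d) (nvd : ¬ G.Adj v d) (nab : ¬ G.Adj a b)
    (nuw : ¬ G.Adj u w) (huw : u ≠ w) (hdx : d ≠ x) : False :=
  hG.false_of_certificate [u, w, v, a, b, c, d, x, y]
    [(0, [2, 3, 4, 5, 6]), (1, [2, 3, 4, 7, 8])] [(2, 3), (2, 4), (3, 7), (4, 6)]
    [(2, 6), (3, 4), (0, 1)] [(0, 1), (6, 7)] [(1, 3, 7), (0, 2, 3), (0, 4, 6), (1, 2, 4)]
    [(3, 7), (2, 3), (4, 6), (2, 4), (0, 5), (1, 7), (1, 8), (0, 6)]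

theorem conf_three_common_six_edge (hG : NoReducible G) {u w v a b c d x y z : V}
    (hu : NbrList G u [v, a, b, c, d]) (hw : NbrList G w [v, a, b, x, y, z]) (eva : G.Adj v a)
    (evb : G.Adj v b) (eab : G.Adj a b) (ead : G.Adj a d) (ebd : G.Adj b d) (eby : G.Adj b y)
    (ecd : G.Adj c d) (exz : G.Adj x z) (nvd : ¬ G.Adj v d) (nuw : ¬ G.Adj u w) (huw : u ≠ w)
    (hcx : c ≠ x) (hcy : c ≠ y) (hcz : c ≠ z) (hdx : d ≠ x) (hdy : d ≠ y) (hdz : d ≠ z) : False :=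
  hG.false_of_certificate [u, w, v, a, b, c, d, x, y, z]
    [(0, [2, 3, 4, 5, 6]), (1, [2, 3, 4, 7, 8, 9])]
    [(2, 3), (2, 4), (3, 4), (3, 6), (4, 6), (4, 8), (5, 6), (7, 9)] [(2, 6), (0, 1)]
    [(0, 1), (5, 7), (5, 8), (5, 9), (6, 7), (6, 8), (6, 9)]
    [(3, 4, 6), (1, 2, 3), (1, 4, 8), (0, 2, 4), (0, 5, 6), (1, 7, 9)]
    [(3, 4), (3, 6), (2, 3), (4, 8), (4, 6), (2, 4), (5, 6), (0, 5), (7, 9), (1, 7), (1, 8),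
     (1, 9)]

theorem conf_three_common_six_nonedge (hG : NoReducible G) {u w v a b c d x y z : V}
    (hu : NbrList G u [v, a, b, c, d]) (hw : NbrList G w [v, a, b, x, y, z]) (eva : G.Adj v a)
    (evb : G.Adj v b) (eby : G.Adj b y) (ecd : G.Adj c d) (exz : G.Adj x z) (nvd : ¬ G.Adj v d)
    (nab : ¬ G.Adj a b) (nuw : ¬ G.Adj u w) (huw : u ≠ w) (hcx : c ≠ x) (hcy : c ≠ y) (hcz : c ≠ z)
    (hdx : d ≠ x) (hdy : d ≠ y) (hdz : d ≠ z) : False :=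
  hG.false_of_certificate [u, w, v, a, b, c, d, x, y, z]
    [(0, [2, 3, 4, 5, 6]), (1, [2, 3, 4, 7, 8, 9])] [(2, 3), (2, 4), (4, 8), (5, 6), (7, 9)]
    [(2, 6), (3, 4), (0, 1)] [(0, 1), (5, 7), (5, 8), (5, 9), (6, 7), (6, 8), (6, 9)]
    [(1, 2, 3), (1, 4, 8), (0, 2, 4), (0, 5, 6), (1, 7, 9)]
    [(2, 3), (4, 8), (2, 4), (5, 6), (0, 5), (7, 9), (1, 7), (1, 8), (1, 9), (0, 6)]

/-- If `v` and `d` are nonadjacent neighbours of the 5-vertex `u`, then `u` and another low vertex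
adjacent to `v` have at most one common neighbour adjacent to `v`. -/
theorem five_low_false_of_two_common [Finite V] (hG : NoReducible G) (hr : IsRobust G)
    {u w v a b c d : V} (hu : NbrList G u [v, a, b, c, d]) (nvd : ¬ G.Adj v d) (hw : IsLow G w)
    (huw : u ≠ w) (hwv : G.Adj w v) (hwa : G.Adj w a) (hwb : G.Adj w b) : False := by
  have nuw := hu.isLow.not_adj hG hr hw
  have ndv : ¬ G.Adj d v := fun h => nvd h.symm
  have va : G.Adj v a := (hu.adj_or hG hr 0 4 1).resolve_left nvd
  have vb : G.Adj v b := (hu.adj_or hG hr 0 4 2).resolve_left nvd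
  have da : G.Adj d a := (hu.adj_or hG hr 4 0 1).resolve_left ndv
  have db : G.Adj d b := (hu.adj_or hG hr 4 0 2).resolve_left ndv
  have dc : G.Adj d c := (hu.adj_or hG hr 4 0 3).resolve_left ndv
  have hfour : ∀ {p q}, NbrList G u [v, a, b, p, q] → ¬ G.Adj w p := by
    intro p q hl hp
    refine hu.isLow.false_of_four_common hG hr hw huw (a := v) (b := a) (c := b) (d := p)
      (List.Nodup.of_append_left (l₂ := [q]) hl.1)
      (fun x hx => hl.adj (List.mem_append_left [q] hx)) ?_
    simp [*]
  have nwc : ¬ G.Adj w c := hfour hu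
  have nwd : ¬ G.Adj w d := hfour (p := d) (q := c) hu.reorder
  obtain ⟨l, hl, hlen⟩ := exists_nbrList_append_length (G := G) w [v, a, b]
    (List.Nodup.of_append_left (l₂ := [c, d]) hu.1) (by simp [*])
  simp only [List.length_cons, List.length_nil] at hlen
  rcases hw with hw | hw
  · obtain ⟨x, y, rfl⟩ := List.length_eq_two.1 (show l.length = 2 by omega)
    have main : ∀ {x y}, NbrList G w [v, a, b, x, y] → G.Adj a x → False := by
      intro x y hl ax
      have hcx : c ≠ x := by rintro rfl; exact nwc (hl.adj (by simp))
      have hdx : d ≠ x := by rintro rfl; exact nwd (hl.adj (by simp))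
      by_cases ab : G.Adj a b
      · exact conf_three_common_five_edge hG hu hl va vb ab da.symm ax db.symm dc.symm nvd nuw huw
          hcx hdx
      · exact conf_three_common_five_nonedge hG hu hl va vb ax db.symm nvd ab nuw huw hdx
    exact (hl.adj_or hG hr 1 3 4).elim (main hl) (main (x := y) (y := x) hl.reorder)
  · obtain ⟨x, y, z, rfl⟩ := List.length_eq_three.1 (show l.length = 3 by omega)
    have main : ∀ {x y z}, NbrList G w [v, a, b, x, y, z] → G.Adj b y → G.Adj x z → False := by
      intro x y z hl hby hxz
      have hc : ∀ p ∈ [v, a, b, x, y, z], c ≠ p := by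
        rintro p hp rfl; exact nwc (hl.adj hp)
      have hd : ∀ p ∈ [v, a, b, x, y, z], d ≠ p := by
        rintro p hp rfl; exact nwd (hl.adj hp)
      simp only [List.mem_cons, List.not_mem_nil, or_false, forall_eq_or_imp, forall_eq] at hc hd
      obtain ⟨-, -, -, hcx, hcy, hcz⟩ := hc
      obtain ⟨-, -, -, hdx, hdy, hdz⟩ := hd
      by_cases ab : G.Adj a b
      · exact conf_three_common_six_edge hG hu hl va vb ab da.symm db.symm hby dc.symm hxz nvd nuw
          huw hcx hcy hcz hdx hdy hdz
      · exact conf_three_common_six_nonedge hG hu hl va vb hby dc.symm hxz nvd ab nuw huw hcx hcy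
          hcz hdx hdy hdz
    have mx := main (x := y) (y := x) (z := z) hl.reorder
    have my := main (x := x) (y := y) (z := z) hl
    have mz := main (x := x) (y := z) (z := y) hl.reorder
    by_cases hbx : G.Adj b x
    · by_cases hby : G.Adj b y
      · exact (hl.adj_or hG hr 5 3 4).elim (fun h => my hby h.symm) fun h => mx hbx h.symm
      · exact mx hbx ((hl.adj_or hG hr 4 2 5).resolve_left fun h => hby h.symm)
    · exact my ((hl.adj_or hG hr 2 3 4).resolve_left hbx)
        ((hl.adj_or hG hr 3 2 5).resolve_left fun h => hbx h.symm)

/-! ### Neighbours of degree 7 of a 5-vertex -/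

theorem conf_five_seven_universal_nonedge (hG : NoReducible G) {u v a b c d x y : V}
    (hu : NbrList G u [v, a, b, c, d]) (hv : NbrList G v [u, a, b, c, d, x, y]) (eac : G.Adj a c)
    (ead : G.Adj a d) (ebc : G.Adj b c) (ebd : G.Adj b d) (ecd : G.Adj c d) (nab : ¬ G.Adj a b)
    : False :=
  hG.false_of_certificate [u, v, a, b, c, d, x, y]
    [(0, [1, 2, 3, 4, 5]), (1, [0, 2, 3, 4, 5, 6, 7])] [(2, 4), (2, 5), (3, 4), (3, 5), (4, 5)]
    [(2, 3)] [] [(2, 4, 5), (0, 1, 2), (0, 3, 4), (1, 3, 5)]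
    [(2, 4), (2, 5), (3, 4), (3, 5), (4, 5), (1, 6), (1, 7), (0, 1)]

theorem conf_five_seven_universal_clique (hG : NoReducible G) {u v a b c d x y : V}
    (hu : NbrList G u [v, a, b, c, d]) (hv : NbrList G v [u, a, b, c, d, x, y]) (eab : G.Adj a b)
    (ead : G.Adj a d) (ebc : G.Adj b c) (ebd : G.Adj b d) (ecd : G.Adj c d) (edx : G.Adj d x)
    : False :=
  hG.false_of_certificate [u, v, a, b, c, d, x, y]
    [(0, [1, 2, 3, 4, 5]), (1, [0, 2, 3, 4, 5, 6, 7])]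
    [(2, 3), (2, 5), (3, 4), (3, 5), (4, 5), (5, 6)] [] []
    [(2, 3, 5), (0, 1, 2), (1, 3, 4), (0, 4, 5), (1, 5, 6)]
    [(2, 3), (2, 4), (2, 5), (3, 4), (3, 5), (4, 5), (5, 6), (1, 6), (1, 7), (0, 1)]

/-- A neighbour of degree 7 of a 5-vertex `u` is not adjacent to all other neighbours of `u`. -/
theorem five_seven_universal [Finite V] (hG : NoReducible G) (hr : IsRobust G) {u v a b c d : V}
    (hu : NbrList G u [v, a, b, c, d]) (hv : (G.neighborSet v).ncard = 7)
    (hadj : ∀ s ∈ [a, b, c, d], G.Adj v s) : False := by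
  have hvu : G.Adj v u := (hu.adj (by simp)).symm
  obtain ⟨l, hl, hlen⟩ := exists_nbrList_append_length (G := G) v [u, a, b, c, d]
    (List.nodup_cons.2 ⟨fun h => G.irrefl (hu.adj (List.mem_cons_of_mem _ h)),
      (List.nodup_cons.1 hu.1).2⟩) (List.forall_mem_cons.2 ⟨hvu, hadj⟩)
  obtain ⟨x, y, rfl⟩ := List.length_eq_two.1 (show l.length = 2 by simp at hlen; omega)
  -- the neighbours of `u` form a clique
  have main : ∀ {a b c d}, NbrList G u [v, a, b, c, d] → NbrList G v [u, a, b, c, d, x, y] →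
      G.Adj a b := by
    intro a b c d hu hv
    by_contra nab
    have nba : ¬ G.Adj b a := fun h => nab h.symm
    exact conf_five_seven_universal_nonedge hG hu hv ((hu.adj_or hG hr 1 2 3).resolve_left nab)
      ((hu.adj_or hG hr 1 2 4).resolve_left nab) ((hu.adj_or hG hr 2 1 3).resolve_left nba)
      ((hu.adj_or hG hr 2 1 4).resolve_left nba)
      (five_nonadj hG hr (a := a) (b := b) (c := c) (d := d) (e := v) hu.reorder nab) nab
  have main' : ∀ {a b c d x y}, NbrList G u [v, a, b, c, d] →
      NbrList G v [u, a, b, c, d, x, y] →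
      (∀ {a b c d}, NbrList G u [v, a, b, c, d] → NbrList G v [u, a, b, c, d, x, y] →
        G.Adj a b) → ¬ G.Adj d x := by
    intro a b c d x y hu hv h dx
    exact conf_five_seven_universal_clique hG hu hv (h hu hv)
      (h (a := a) (b := d) (c := b) (d := c) hu.reorder hv.reorder)
      (h (a := b) (b := c) (c := a) (d := d) hu.reorder hv.reorder)
      (h (a := b) (b := d) (c := a) (d := c) hu.reorder hv.reorder)
      (h (a := c) (b := d) (c := a) (d := b) hu.reorder hv.reorder) dx
  -- the other two neighbours of `v` are joined to this clique
  obtain ⟨s, hs, t, ht, hvt, hst⟩ := hr.exists_adj_not_mem (v := v) (l := [x, y]) (by simp)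
    (by simp) (fun s hs => hl.adj (List.mem_append_right [u, a, b, c, d] hs))
  have hsplit : ∀ {a b c d}, NbrList G u [v, a, b, c, d] → NbrList G v [u, a, b, c, d, x, y] →
      ¬ G.Adj d x ∧ ¬ G.Adj d y := by
    intro a b c d hu hv
    exact ⟨main' hu hv main, main' (x := y) (y := x) hu hv.reorder
      fun hu hv => main hu hv.reorder⟩
  have hnu : ∀ {x y}, NbrList G v [u, a, b, c, d, x, y] → ¬ G.Adj u x := by
    intro x y hl h
    have hmem := (hu.2 x).1 h
    have hn := hl.nodup_cons
    simp only [List.nodup_cons, List.mem_cons, List.not_mem_nil, or_false] at hn hmem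
    tauto
  have h1 := hsplit hu hl
  have h2 := hsplit (a := a) (b := b) (c := d) (d := c) hu.reorder hl.reorder
  have h3 := hsplit (a := a) (b := d) (c := c) (d := b) hu.reorder hl.reorder
  have h4 := hsplit (a := d) (b := b) (c := c) (d := a) hu.reorder hl.reorder
  have hux := hnu hl
  have huy := hnu (x := y) (y := x) hl.reorder
  have htm := (hl.2 t).1 hvt
  simp only [List.cons_append, List.nil_append, List.mem_cons, List.not_mem_nil, or_false,
    not_or] at hs ht htm
  have hts := hst.symm
  rcases hs with rfl | rfl <;> rcases htm with rfl | rfl | rfl | rfl | rfl | htm <;> tauto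

/-- The neighbour `y` of `v` has no neighbour among `u`, `x`, `z`, and `x` and `z` are adjacent. -/
theorem conf_seven_isolated_ext (hG : NoReducible G) {v u p q r x y z : V}
    (hv : NbrList G v [u, p, q, r, x, y, z]) (eup : G.Adj u p) (eqr : G.Adj q r) (exz : G.Adj x z)
    (nxy : ¬ G.Adj x y) (nyz : ¬ G.Adj y z) (nux : ¬ G.Adj u x) (nuy : ¬ G.Adj u y)
    (nuz : ¬ G.Adj u z) : False :=
  hG.false_of_certificate [v, u, p, q, r, x, y, z]
    [(0, [1, 2, 3, 4, 5, 6, 7])] [(1, 2), (3, 4), (5, 7)] [(5, 6), (6, 7), (1, 5), (1, 6), (1, 7)]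
    [] [(0, 1, 2), (0, 3, 4), (0, 5, 7)] [(1, 2), (0, 2), (3, 4), (0, 3), (0, 4), (5, 7)]

theorem conf_seven_matching (hG : NoReducible G) {u v w p q r x y z : V}
    (hu : NbrList G u [v, w, p, q, r]) (hv : NbrList G v [u, p, q, r, x, y, z]) (ewr : G.Adj w r)
    (epq : G.Adj p q) (epy : G.Adj p y) (eqz : G.Adj q z) (erx : G.Adj r x) (npz : ¬ G.Adj p z)
    (nvw : ¬ G.Adj v w) (nuz : ¬ G.Adj u z) : False :=
  hG.false_of_certificate [u, v, w, p, q, r, x, y, z]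
    [(0, [1, 2, 3, 4, 5]), (1, [0, 3, 4, 5, 6, 7, 8])] [(2, 5), (3, 4), (3, 7), (4, 8), (5, 6)]
    [(3, 8), (1, 2), (0, 8)] [] [(0, 3, 4), (1, 3, 7), (1, 4, 8), (1, 5, 6), (0, 2, 5)]
    [(3, 4), (3, 7), (0, 3), (4, 8), (0, 4), (5, 6), (1, 5), (2, 5), (1, 6), (1, 7)]

theorem conf_seven_split_core (hG : NoReducible G) {u v w p q r x y z : V}
    (hu : NbrList G u [v, w, p, q, r]) (hv : NbrList G v [u, p, q, r, x, y, z]) (ewr : G.Adj w r)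
    (epq : G.Adj p q) (epy : G.Adj p y) (eqr : G.Adj q r) (exz : G.Adj x z) (nqy : ¬ G.Adj q y)
    (nvw : ¬ G.Adj v w) (nuy : ¬ G.Adj u y) : False :=
  hG.false_of_certificate [u, v, w, p, q, r, x, y, z]
    [(0, [1, 2, 3, 4, 5]), (1, [0, 3, 4, 5, 6, 7, 8])] [(2, 5), (3, 4), (3, 7), (4, 5), (6, 8)]
    [(4, 7), (1, 2), (0, 7)] [] [(0, 3, 4), (1, 3, 7), (1, 4, 5), (0, 2, 5), (1, 6, 8)]
    [(3, 4), (3, 7), (0, 3), (4, 5), (0, 4), (1, 5), (2, 5), (6, 8), (1, 6), (1, 8)]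

/-- The vertex `x` is not adjacent to the common neighbours `p`, `q`, `r` of `u` and `v`. -/
theorem conf_seven_unattached_ext (hG : NoReducible G) {u v w p q r x y z : V}
    (hu : NbrList G u [v, w, p, q, r]) (hv : NbrList G v [u, p, q, r, x, y, z]) (ewp : G.Adj w p)
    (ewq : G.Adj w q) (ewr : G.Adj w r) (epq : G.Adj p q) (epr : G.Adj p r) (eyz : G.Adj y z)
    (npx : ¬ G.Adj p x) (nqx : ¬ G.Adj q x) (nrx : ¬ G.Adj r x) (hd : [w, y, z].Nodup) : False :=
  hG.false_of_certificate [u, v, w, p, q, r, x, y, z]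
    [(0, [1, 2, 3, 4, 5]), (1, [0, 3, 4, 5, 6, 7, 8])]
    [(2, 3), (2, 4), (2, 5), (3, 4), (3, 5), (7, 8)] [(3, 6), (4, 6), (5, 6)] [(2, 7), (2, 8)]
    [(2, 3, 4), (1, 3, 5), (0, 1, 4), (0, 2, 5), (1, 7, 8)]
    [(3, 4), (3, 5), (2, 3), (4, 5), (2, 4), (2, 5), (7, 8), (1, 7), (1, 8), (0, 1)]

theorem conf_seven_indep_ext_two (hG : NoReducible G) {v u p q r x y z : V}
    (hv : NbrList G v [u, p, q, r, x, y, z]) (euq : G.Adj u q) (epx : G.Adj p x) (ery : G.Adj r y)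
    (nqy : ¬ G.Adj q y) (nqz : ¬ G.Adj q z) (nyz : ¬ G.Adj y z) (nux : ¬ G.Adj u x)
    (nuy : ¬ G.Adj u y) (nuz : ¬ G.Adj u z) : False :=
  hG.false_of_certificate [v, u, p, q, r, x, y, z]
    [(0, [1, 2, 3, 4, 5, 6, 7])] [(1, 3), (2, 5), (4, 6)]
    [(3, 6), (3, 7), (6, 7), (1, 5), (1, 6), (1, 7)] [] [(0, 2, 5), (0, 1, 3), (0, 4, 6)]
    [(2, 5), (0, 2), (1, 3), (4, 6), (0, 4), (0, 5)]

theorem conf_seven_complete_pair (hG : NoReducible G) {u v w p q r x y z : V}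
    (hu : NbrList G u [v, w, p, q, r]) (hv : NbrList G v [u, p, q, r, x, y, z]) (epq : G.Adj p q)
    (epr : G.Adj p r) (epy : G.Adj p y) (epz : G.Adj p z) (eqr : G.Adj q r) (eqy : G.Adj q y)
    (eqz : G.Adj q z) (ery : G.Adj r y) (erz : G.Adj r z) (nyz : ¬ G.Adj y z) : False :=
  hG.false_of_certificate [u, v, w, p, q, r, x, y, z]
    [(0, [1, 2, 3, 4, 5]), (1, [0, 3, 4, 5, 6, 7, 8])]
    [(3, 4), (3, 5), (3, 7), (3, 8), (4, 5), (4, 7), (4, 8), (5, 7), (5, 8)] [(7, 8)] []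
    [(3, 4, 7), (0, 3, 5), (1, 3, 8), (4, 5, 8), (0, 1, 4), (1, 5, 7)]
    [(3, 4), (3, 5), (3, 7), (3, 8), (4, 5), (4, 7), (4, 8), (5, 7), (5, 8), (1, 6), (0, 1),
     (0, 2)]

/-- The common neighbour `q` of `u` and `v` has no neighbour in the
independent set `x`, `y`, `z`. -/
theorem conf_seven_unattached_core (hG : NoReducible G) {v u p q r x y z : V}
    (hv : NbrList G v [u, p, q, r, x, y, z]) (euq : G.Adj u q) (epr : G.Adj p r)
    (nqx : ¬ G.Adj q x) (nqy : ¬ G.Adj q y) (nqz : ¬ G.Adj q z) (nxy : ¬ G.Adj x y)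
    (nxz : ¬ G.Adj x z) (nyz : ¬ G.Adj y z) (nux : ¬ G.Adj u x) (nuy : ¬ G.Adj u y)
    (nuz : ¬ G.Adj u z) : False :=
  hG.false_of_certificate [v, u, p, q, r, x, y, z]
    [(0, [1, 2, 3, 4, 5, 6, 7])] [(1, 3), (2, 4)]
    [(3, 5), (3, 6), (3, 7), (5, 6), (5, 7), (6, 7), (1, 5), (1, 6), (1, 7)] []
    [(0, 2, 4), (0, 1, 3)] [(2, 4), (0, 2), (1, 3), (0, 4)]

/-- The neighbourhoods of a 5-vertex `u` and of a neighbour `v` of `u` of degree 7, where `w` is the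
only neighbour of `u` not adjacent to `v`. -/
structure FiveSeven (G : SimpleGraph V) (u v w p q r x y z : V) : Prop where
  hu : NbrList G u [v, w, p, q, r]
  hv : NbrList G v [u, p, q, r, x, y, z]
  nvw : ¬ G.Adj v w

namespace FiveSeven

variable {u v w p q r x y z : V}

theorem not_adj_ext (h : FiveSeven G u v w p q r x y z) : ¬ G.Adj u x := by
  intro hux
  have hmem := (h.hu.2 x).1 hux
  have hn := h.hv.nodup_cons
  have hxw : x ≠ w := by rintro rfl; exact h.nvw (h.hv.adj (by simp))
  simp only [List.nodup_cons, List.mem_cons, List.not_mem_nil, or_false] at hn hmem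
  tauto

theorem adj_core [Finite V] (hG : NoReducible G) (hr : IsRobust G)
    (h : FiveSeven G u v w p q r x y z) : G.Adj p q :=
  five_nonadj hG hr h.hu h.nvw

theorem adj_opposite [Finite V] (hG : NoReducible G) (hr : IsRobust G)
    (h : FiveSeven G u v w p q r x y z) : G.Adj w p :=
  (h.hu.adj_or hG hr 1 0 2).resolve_left fun e => h.nvw e.symm

theorem ne_opposite (h : FiveSeven G u v w p q r x y z) : w ≠ x := by
  rintro rfl; exact h.nvw (h.hv.adj (by simp))

/-- If two of `x, y, z` are adjacent, then the third is adjacent to `p, q, r`. -/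
theorem adj_of_adj [Finite V] (hG : NoReducible G) (hr : IsRobust G)
    (h : FiveSeven G u v w p q r x y z) (hyz : G.Adj y z) :
    G.Adj p x ∧ G.Adj q x ∧ G.Adj r x := by
  have key : ∀ {p q r}, FiveSeven G u v w p q r x y z → G.Adj p x → G.Adj q x := by
    intro p q r h px
    by_contra nqx
    have h1 : FiveSeven G u v w r p q x y z := ⟨h.hu.reorder, h.hv.reorder, h.nvw⟩
    have h2 : FiveSeven G u v w q r p x y z := ⟨h.hu.reorder, h.hv.reorder, h.nvw⟩
    exact conf_seven_split_core hG (x := y) (y := x) (z := z) h.hu h.hv.reorder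
      (h1.adj_opposite hG hr) (h.adj_core hG hr) px (h2.adj_core hG hr) hyz nqx h.nvw h.not_adj_ext
  have hqr : FiveSeven G u v w p r q x y z := ⟨h.hu.reorder, h.hv.reorder, h.nvw⟩
  have hqp : FiveSeven G u v w q p r x y z := ⟨h.hu.reorder, h.hv.reorder, h.nvw⟩
  have hrp : FiveSeven G u v w r p q x y z := ⟨h.hu.reorder, h.hv.reorder, h.nvw⟩
  by_cases px : G.Adj p x
  · exact ⟨px, key h px, key hqr px⟩
  have nqx : ¬ G.Adj q x := fun e => px (key hqp e)
  have nrx : ¬ G.Adj r x := fun e => px (key hrp e)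
  have hy : FiveSeven G u v w p q r y x z := ⟨h.hu, h.hv.reorder, h.nvw⟩
  have hz : FiveSeven G u v w p q r z x y := ⟨h.hu, h.hv.reorder, h.nvw⟩
  exact (conf_seven_unattached_ext hG h.hu h.hv (h.adj_opposite hG hr) (hqp.adj_opposite hG hr)
    (hrp.adj_opposite hG hr) (h.adj_core hG hr) (hqr.adj_core hG hr) hyz px nqx nrx
    (by simp [hy.ne_opposite, hz.ne_opposite, hyz.ne])).elim

/-- If `y` and `z` are both adjacent to `p, q, r`, then they are adjacent to each other. -/
theorem adj_ext_of_adj [Finite V] (hG : NoReducible G) (hr : IsRobust G)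
    (h : FiveSeven G u v w p q r x y z) (hy : G.Adj p y ∧ G.Adj q y ∧ G.Adj r y)
    (hz : G.Adj p z ∧ G.Adj q z ∧ G.Adj r z) : G.Adj y z := by
  by_contra nyz
  have hqr : FiveSeven G u v w p r q x y z := ⟨h.hu.reorder, h.hv.reorder, h.nvw⟩
  have hqp : FiveSeven G u v w q r p x y z := ⟨h.hu.reorder, h.hv.reorder, h.nvw⟩
  exact conf_seven_complete_pair hG h.hu h.hv (h.adj_core hG hr) (hqr.adj_core hG hr) hy.1 hz.1
    (hqp.adj_core hG hr) hy.2.1 hz.2.1 hy.2.2 hz.2.2 nyz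

/-- The conclusion of `FiveSeven.clique`, provided that `x, y, z` are not independent. -/
theorem clique_of_adj [Finite V] (hG : NoReducible G) (hr : IsRobust G)
    (h : FiveSeven G u v w p q r x y z) (hxz : G.Adj x z) :
    (G.Adj x y ∧ G.Adj x z ∧ G.Adj y z) ∧ (G.Adj p x ∧ G.Adj q x ∧ G.Adj r x) ∧
      (G.Adj p y ∧ G.Adj q y ∧ G.Adj r y) ∧ (G.Adj p z ∧ G.Adj q z ∧ G.Adj r z) := by
  have h1 : FiveSeven G u v w p q r y x z := ⟨h.hu, h.hv.reorder, h.nvw⟩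
  have h2 : FiveSeven G u v w p q r z x y := ⟨h.hu, h.hv.reorder, h.nvw⟩
  have h3 : FiveSeven G u v w q r p x y z := ⟨h.hu.reorder, h.hv.reorder, h.nvw⟩
  have hy := h1.adj_of_adj hG hr hxz
  by_cases xy : G.Adj x y
  · have hz := h2.adj_of_adj hG hr xy
    have yz := h.adj_ext_of_adj hG hr hy hz
    exact ⟨⟨xy, hxz, yz⟩, h.adj_of_adj hG hr yz, hy, hz⟩
  by_cases yz : G.Adj y z
  · have hx := h.adj_of_adj hG hr yz
    exact ⟨⟨h2.adj_ext_of_adj hG hr hx hy, hxz, yz⟩, hx, hy,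
      h2.adj_of_adj hG hr (h2.adj_ext_of_adj hG hr hx hy)⟩
  exact (conf_seven_isolated_ext hG h.hv (h.hu.adj (by simp)) (h3.adj_core hG hr) hxz xy yz
    h.not_adj_ext h1.not_adj_ext h2.not_adj_ext).elim

/-- If `x` and `y` are nonadjacent, then there is no perfect matching between `x, y, z` and
`p, q, r`: exchanging matching edges, `x` and `y` would both be joined to all of `p, q, r`, and
hence to each other. -/
theorem not_matching [Finite V] (hG : NoReducible G) (hr : IsRobust G)
    (h : FiveSeven G u v w p q r x y z) (nxy : ¬ G.Adj x y) (hpx : G.Adj p x)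
    (hqy : G.Adj q y) (hrz : G.Adj r z) : False := by
  have key : ∀ {p q r x y z}, FiveSeven G u v w p q r x y z → G.Adj p y → G.Adj q z →
      G.Adj r x → G.Adj p z := by
    intro p q r x y z h py qz rx
    by_contra npz
    have h1 : FiveSeven G u v w r p q x y z := ⟨h.hu.reorder, h.hv.reorder, h.nvw⟩
    have h2 : FiveSeven G u v w p q r z x y := ⟨h.hu, h.hv.reorder, h.nvw⟩
    exact conf_seven_matching hG h.hu h.hv (h1.adj_opposite hG hr) (h.adj_core hG hr) py qz rx npz
      h.nvw h2.not_adj_ext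
  have h1 : FiveSeven G u v w q p r z y x := ⟨h.hu.reorder, h.hv.reorder, h.nvw⟩
  have h2 : FiveSeven G u v w r p q y z x := ⟨h.hu.reorder, h.hv.reorder, h.nvw⟩
  have h3 : FiveSeven G u v w p q r z x y := ⟨h.hu.reorder, h.hv.reorder, h.nvw⟩
  have h4 : FiveSeven G u v w r q p x z y := ⟨h.hu.reorder, h.hv.reorder, h.nvw⟩
  exact nxy (h3.adj_ext_of_adj hG hr ⟨hpx, key h1 hqy hpx hrz, key h2 hrz hpx hqy⟩
    ⟨key h3 hpx hqy hrz, hqy, key h4 hrz hqy hpx⟩)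

theorem adj_or_of_adj (hG : NoReducible G) (h : FiveSeven G u v w p q r x y z)
    (nyz : ¬ G.Adj y z) (px : G.Adj p x) (ry : G.Adj r y) : G.Adj q y ∨ G.Adj q z := by
  by_contra! hn
  exact conf_seven_indep_ext_two hG h.hv (h.hu.adj (by simp)) px ry hn.1 hn.2 nyz h.not_adj_ext
    (not_adj_ext (x := y) (y := x) ⟨h.hu, h.hv.reorder, h.nvw⟩)
    (not_adj_ext (x := z) (y := x) (z := y) ⟨h.hu, h.hv.reorder, h.nvw⟩)

theorem exists_adj_core (hr : IsRobust G) (h : FiveSeven G u v w p q r x y z)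
    (nxy : ¬ G.Adj x y) (nxz : ¬ G.Adj x z) : G.Adj p x ∨ G.Adj q x ∨ G.Adj r x := by
  obtain ⟨t, hvt, hxt⟩ := hr.exists_common_nbr (h.hv.adj (x := x) (by simp))
  have ht := (h.hv.2 t).1 hvt
  simp only [List.mem_cons, List.not_mem_nil, or_false] at ht
  rcases ht with rfl | rfl | rfl | rfl | rfl | rfl | rfl
  · exact absurd hxt.symm h.not_adj_ext
  · exact Or.inl hxt.symm
  · exact Or.inr (Or.inl hxt.symm)
  · exact Or.inr (Or.inr hxt.symm)
  · exact absurd hxt G.irrefl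
  · exact absurd hxt nxy
  · exact absurd hxt nxz

/-- If `x, y, z` are independent and `p` is adjacent to `x`, then `r` is not adjacent to `y`:
otherwise the edges to `p, q, r` would contain a perfect matching. -/
theorem not_adj_of_indep [Finite V] (hG : NoReducible G) (hr : IsRobust G)
    (h : FiveSeven G u v w p q r x y z) (nxy : ¬ G.Adj x y) (nxz : ¬ G.Adj x z)
    (nyz : ¬ G.Adj y z) (px : G.Adj p x) : ¬ G.Adj r y := by
  intro ry
  have nqz : ¬ G.Adj q z := fun qz =>
    not_matching hG hr (p := p) (q := r) (r := q) (x := x) (y := y) (z := z)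
      ⟨h.hu.reorder, h.hv.reorder, h.nvw⟩ nxy px ry qz
  have qy := (h.adj_or_of_adj hG nyz px ry).resolve_right nqz
  have nrz : ¬ G.Adj r z := h.not_matching hG hr nxy px qy
  have hz := exists_adj_core hr (x := z) (y := x) (z := y) ⟨h.hu, h.hv.reorder, h.nvw⟩
    (fun e => nxz e.symm) fun e => nyz e.symm
  have pz : G.Adj p z := by tauto
  have nqx : ¬ G.Adj q x := fun qx =>
    not_matching hG hr (p := q) (q := r) (r := p) (x := x) (y := y) (z := z)
      ⟨h.hu.reorder, h.hv.reorder, h.nvw⟩ nxy qx ry pz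
  exact (adj_or_of_adj hG (p := r) (q := q) (r := p) (x := y) (y := x) (z := z)
    ⟨h.hu.reorder, h.hv.reorder, h.nvw⟩ nxz ry px).elim nqx nqz

/-- The vertices `x, y, z` are not independent. -/
theorem false_of_indep [Finite V] (hG : NoReducible G) (hr : IsRobust G)
    (h : FiveSeven G u v w p q r x y z) (nxy : ¬ G.Adj x y) (nxz : ¬ G.Adj x z)
    (nyz : ¬ G.Adj y z) : False := by
  have nyx : ¬ G.Adj y x := fun e => nxy e.symm
  have nzy : ¬ G.Adj z y := fun e => nyz e.symm
  have main : ∀ {p q r}, FiveSeven G u v w p q r x y z → ¬ G.Adj p x := by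
    intro p q r h px
    have ry := h.not_adj_of_indep hG hr nxy nxz nyz px
    have rz := not_adj_of_indep hG hr (x := x) (y := z) (z := y)
      ⟨h.hu, h.hv.reorder, h.nvw⟩ nxz nxy nzy px
    have qy := not_adj_of_indep hG hr (p := p) (q := r) (r := q)
      ⟨h.hu.reorder, h.hv.reorder, h.nvw⟩ nxy nxz nyz px
    have qz := not_adj_of_indep hG hr (p := p) (q := r) (r := q) (x := x) (y := z) (z := y)
      ⟨h.hu.reorder, h.hv.reorder, h.nvw⟩ nxz nxy nzy px
    have hy := exists_adj_core hr (x := y) (y := x) (z := z) ⟨h.hu, h.hv.reorder, h.nvw⟩ nyx nyz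
    have py : G.Adj p y := by tauto
    have h1 : FiveSeven G u v w p r q x y z := ⟨h.hu.reorder, h.hv.reorder, h.nvw⟩
    have qx : G.Adj q x := by
      by_contra qx
      exact conf_seven_unattached_core hG h.hv (h.hu.adj (by simp)) (h1.adj_core hG hr) qx qy qz
        nxy nxz nyz h.not_adj_ext (not_adj_ext (x := y) (y := x) ⟨h.hu, h.hv.reorder, h.nvw⟩)
        (not_adj_ext (x := z) (y := x) (z := y) ⟨h.hu, h.hv.reorder, h.nvw⟩)
    exact (adj_or_of_adj hG (p := q) (q := r) (r := p) (x := x) (y := y) (z := z)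
      ⟨h.hu.reorder, h.hv.reorder, h.nvw⟩ nyz qx py).elim ry rz
  rcases h.exists_adj_core hr nxy nxz with e | e | e
  · exact main h e
  · exact main (p := q) (q := p) (r := r) ⟨h.hu.reorder, h.hv.reorder, h.nvw⟩ e
  · exact main (p := r) (q := p) (r := q) ⟨h.hu.reorder, h.hv.reorder, h.nvw⟩ e

/-- The neighbours of `v` other than `u` form a clique. -/
theorem clique [Finite V] (hG : NoReducible G) (hr : IsRobust G)
    (h : FiveSeven G u v w p q r x y z) :
    (G.Adj x y ∧ G.Adj x z ∧ G.Adj y z) ∧ (G.Adj p x ∧ G.Adj q x ∧ G.Adj r x) ∧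
      (G.Adj p y ∧ G.Adj q y ∧ G.Adj r y) ∧ (G.Adj p z ∧ G.Adj q z ∧ G.Adj r z) := by
  by_cases xz : G.Adj x z
  · exact h.clique_of_adj hG hr xz
  by_cases xy : G.Adj x y
  · have := clique_of_adj hG hr (x := x) (y := z) (z := y) ⟨h.hu, h.hv.reorder, h.nvw⟩ xy
    exact absurd this.1.1 xz
  by_cases yz : G.Adj y z
  · have := clique_of_adj hG hr (x := y) (y := x) (z := z) ⟨h.hu, h.hv.reorder, h.nvw⟩ yz
    exact absurd this.1.1.symm xy
  exact (h.false_of_indep hG hr xy xz yz).elim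

end FiveSeven

/-- The vertices `v` and `w` have no common neighbour besides `u`, `p`, `q`, `r`. -/
theorem conf_two_sevens_disjoint (hG : NoReducible G) {u v w p q r x y z a b c : V}
    (hu : NbrList G u [v, w, p, q, r]) (hv : NbrList G v [u, p, q, r, x, y, z])
    (hw : NbrList G w [u, p, q, r, a, b, c]) (epq : G.Adj p q) (epr : G.Adj p r) (epa : G.Adj p a)
    (eqr : G.Adj q r) (eqz : G.Adj q z) (eqa : G.Adj q a) (era : G.Adj r a) (exy : G.Adj x y)
    (ebc : G.Adj b c) (nux : ¬ G.Adj u x) (nuy : ¬ G.Adj u y) (nvw : ¬ G.Adj v w)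
    (hd : [x, y, z, a, b, c].Nodup) : False :=
  hG.false_of_certificate [u, v, w, p, q, r, x, y, z, a, b, c]
    [(0, [1, 2, 3, 4, 5]), (1, [0, 3, 4, 5, 6, 7, 8]), (2, [0, 3, 4, 5, 9, 10, 11])]
    [(3, 4), (3, 5), (3, 9), (4, 5), (4, 8), (4, 9), (5, 9), (6, 7), (10, 11)]
    [(0, 6), (0, 7), (1, 2)]
    [(6, 9), (6, 10), (6, 11), (7, 9), (7, 10), (7, 11), (8, 9), (8, 10), (8, 11)]
    [(0, 3, 4), (1, 3, 5), (2, 3, 9), (4, 5, 9), (1, 4, 8), (0, 2, 5), (1, 6, 7), (2, 10, 11)]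
    [(3, 4), (3, 5), (3, 9), (1, 3), (4, 5), (4, 8), (4, 9), (1, 4), (5, 9), (1, 5), (6, 7),
     (1, 8), (10, 11), (2, 10), (2, 11), (0, 2)]

/-- The vertices `v` and `w` have the common neighbour `x` besides `u`, `p`, `q`, `r`. -/
theorem conf_two_sevens_share_one (hG : NoReducible G) {u v w p q r x y z a b : V}
    (hu : NbrList G u [v, w, p, q, r]) (hv : NbrList G v [u, p, q, r, x, y, z])
    (hw : NbrList G w [u, p, q, r, x, a, b]) (epq : G.Adj p q) (epr : G.Adj p r) (epx : G.Adj p x)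
    (eqx : G.Adj q x) (eqb : G.Adj q b) (eyz : G.Adj y z) (nvw : ¬ G.Adj v w) (nux : ¬ G.Adj u x)
    (hd : [y, z, b].Nodup) : False :=
  hG.false_of_certificate [u, v, w, p, q, r, x, y, z, a, b]
    [(0, [1, 2, 3, 4, 5]), (1, [0, 3, 4, 5, 6, 7, 8]), (2, [0, 3, 4, 5, 6, 9, 10])]
    [(3, 4), (3, 5), (3, 6), (4, 6), (4, 10), (7, 8)] [(1, 2), (0, 6)] [(7, 10), (8, 10)]
    [(0, 3, 4), (1, 3, 5), (2, 3, 6), (1, 4, 6), (2, 4, 10), (0, 2, 5), (1, 7, 8)]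
    [(3, 4), (3, 5), (3, 6), (0, 3), (4, 6), (4, 10), (0, 4), (1, 5), (2, 5), (7, 8), (1, 7),
     (1, 8), (2, 9), (2, 10)]

/-- The vertices `v` and `w` have the common neighbours `x` and `y` besides `u`, `p`, `q`, `r`;
`z` and `a` may coincide. -/
theorem conf_two_sevens_share_two (hG : NoReducible G) {u v w p q r x y z a : V}
    (hu : NbrList G u [v, w, p, q, r]) (hv : NbrList G v [u, p, q, r, x, y, z])
    (hw : NbrList G w [u, p, q, r, x, y, a]) (epr : G.Adj p r) (epz : G.Adj p z) (eqx : G.Adj q x)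
    (exy : G.Adj x y) (nvw : ¬ G.Adj v w) (nux : ¬ G.Adj u x) (nuy : ¬ G.Adj u y) : False :=
  hG.false_of_certificate [u, v, w, p, q, r, x, y, z, a]
    [(0, [1, 2, 3, 4, 5]), (1, [0, 3, 4, 5, 6, 7, 8]), (2, [0, 3, 4, 5, 6, 7, 9])]
    [(3, 5), (3, 8), (4, 6), (6, 7)] [(1, 2), (0, 6), (0, 7)] []
    [(2, 3, 5), (1, 3, 8), (1, 4, 6), (0, 2, 4), (0, 1, 5), (2, 6, 7)]
    [(3, 5), (3, 8), (1, 3), (2, 3), (4, 6), (4, 7), (0, 4), (1, 5), (2, 5), (6, 7), (1, 8),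
     (2, 9)]

/-- Two neighbours `v`, `w` of degree 7 of a 5-vertex are not nonadjacent. -/
theorem five_seven_nonadj [Finite V] (hG : NoReducible G) (hr : IsRobust G) {u v w p q r : V}
    (hu : NbrList G u [v, w, p, q, r]) (nvw : ¬ G.Adj v w) (hv : (G.neighborSet v).ncard = 7)
    (hw : (G.neighborSet w).ncard = 7) : False := by
  have hn := hu.nodup_cons
  have hext : ∀ {v w}, NbrList G u [v, w, p, q, r] → ¬ G.Adj v w → (G.neighborSet v).ncard = 7 →
      ∃ x y z, FiveSeven G u v w p q r x y z := by
    intro v w hu nvw hv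
    have hvp : ∀ i (hi : i < 5) (hi' : 2 ≤ i), G.Adj v ([v, w, p, q, r][i]) := fun i hi hi' =>
      (hu.adj_or hG hr 0 1 i (by simp) ⟨by simp, by simp, hi⟩
        (by omega)).resolve_left nvw
    obtain ⟨l, hl, hlen⟩ := exists_nbrList_append_length (G := G) v [u, p, q, r]
      (hu.nodup_cons.sublist (by simp))
      (by simpa [(hu.adj (x := v) (by simp)).symm] using
        ⟨hvp 2 (by simp) (by simp), hvp 3 (by simp) (by simp), hvp 4 (by simp) (by simp)⟩)
    obtain ⟨x, y, z, rfl⟩ := List.length_eq_three.1 (show l.length = 3 by simp at hlen; omega)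
    exact ⟨x, y, z, hu, hl, nvw⟩
  obtain ⟨x, y, z, hV⟩ := hext hu nvw hv
  obtain ⟨a, b, c, hW⟩ := hext (v := w) (w := v) hu.reorder (fun e => nvw e.symm) hw
  have pq := hV.adj_core hG hr
  have pr : G.Adj p r := FiveSeven.adj_core hG hr (q := r) (r := q)
    ⟨hV.hu.reorder, hV.hv.reorder, hV.nvw⟩
  have qr : G.Adj q r := FiveSeven.adj_core hG hr (p := q) (q := r) (r := p)
    ⟨hV.hu.reorder, hV.hv.reorder, hV.nvw⟩
  -- two common neighbours of `v` and `w` outside the closed neighbourhood of `u`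
  have two : ∀ {x y z c}, FiveSeven G u v w p q r x y z → FiveSeven G u w v p q r x y c →
      False := by
    intro x y z c hV hW
    obtain ⟨⟨xy, -, -⟩, ⟨-, qx, -⟩, -, ⟨pz, -, -⟩⟩ := hV.clique hG hr
    exact conf_two_sevens_share_two hG hV.hu hV.hv hW.hv pr pz qx xy nvw hV.not_adj_ext
      (FiveSeven.not_adj_ext (x := y) (y := x) ⟨hV.hu, hV.hv.reorder, nvw⟩)
  have one : ∀ {x y z a b c}, FiveSeven G u v w p q r x y z → FiveSeven G u w v p q r a b c →
      x ≠ a := by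
    rintro x y z _ b c hV hW rfl
    have sv : FiveSeven G u v w p q r x z y := ⟨hV.hu, hV.hv.reorder, hV.nvw⟩
    have sw : FiveSeven G u w v p q r x c b := ⟨hW.hu, hW.hv.reorder, hW.nvw⟩
    have hyc : y ≠ c := by rintro rfl; exact two hV sw
    have hzc : z ≠ c := by rintro rfl; exact two sv sw
    obtain ⟨⟨-, -, yz⟩, ⟨px, qx, -⟩, -⟩ := hV.clique hG hr
    obtain ⟨-, -, -, ⟨-, qc, -⟩⟩ := hW.clique hG hr
    exact conf_two_sevens_share_one hG hV.hu hV.hv hW.hv pq pr px qx qc yz nvw hV.not_adj_ext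
      (by simp [yz.ne, hyc, hzc])
  have sv : FiveSeven G u v w p q r y x z := ⟨hV.hu, hV.hv.reorder, hV.nvw⟩
  have sv' : FiveSeven G u v w p q r z x y := ⟨hV.hu, hV.hv.reorder, hV.nvw⟩
  have sw : FiveSeven G u w v p q r b a c := ⟨hW.hu, hW.hv.reorder, hW.nvw⟩
  have sw' : FiveSeven G u w v p q r c a b := ⟨hW.hu, hW.hv.reorder, hW.nvw⟩
  obtain ⟨⟨xy, xz, yz⟩, -, -, ⟨-, qz, -⟩⟩ := hV.clique hG hr
  obtain ⟨⟨ab, ac, bc⟩, ⟨pa, qa, ra⟩, -⟩ := hW.clique hG hr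
  exact conf_two_sevens_disjoint hG hV.hu hV.hv hW.hv pq pr pa qr qz qa ra xy bc hV.not_adj_ext
    sv.not_adj_ext nvw (by
      simp [xy.ne, xz.ne, yz.ne, ab.ne, ac.ne, bc.ne, one hV hW, one hV sw, one hV sw', one sv hW,
        one sv sw, one sv sw', one sv' hW, one sv' sw, one sv' sw'])

/-- A 5-vertex has at most one neighbour of degree 7. -/
theorem five_at_most_one_seven [Finite V] (hG : NoReducible G) (hr : IsRobust G) {u v w : V}
    (hu : (G.neighborSet u).ncard = 5) (huv : G.Adj u v) (huw : G.Adj u w) (hvw : v ≠ w)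
    (hv : (G.neighborSet v).ncard = 7) (hw : (G.neighborSet w).ncard = 7) : False := by
  have hlow : IsLow G u := Or.inl hu
  have hnon : ∀ {v}, G.Adj u v → (G.neighborSet v).ncard = 7 →
      ∃ s, G.Adj u s ∧ s ≠ v ∧ ¬ G.Adj v s := by
    intro v huv hv
    by_contra! hc
    obtain ⟨l, hl, hlen⟩ := exists_nbrList_append_length (G := G) u [v] (by simp) (by simp [huv])
    obtain ⟨a, b, c, d, rfl⟩ := List.length_eq_four.1 (show l.length = 4 by simp at hlen; omega)
    refine five_seven_universal hG hr hl hv fun s hs => hc s (hl.adj (List.mem_cons_of_mem _ hs)) ?_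
    rintro rfl
    exact (List.nodup_cons.1 hl.1).1 hs
  by_cases nvw : G.Adj v w
  · obtain ⟨s, hus, hsv, nvs⟩ := hnon huv hv
    obtain ⟨t, hut, htw, nwt⟩ := hnon huw hw
    have hsw : s ≠ w := by rintro rfl; exact nvs nvw
    have htv : t ≠ v := by rintro rfl; exact nwt nvw.symm
    by_cases hst : s = t
    · subst hst
      exact (hlow.adj_or_adj hG hr hus huv huw hsv hsw hvw).elim (fun e => nvs e.symm)
        fun e => nwt e.symm
    · obtain ⟨l, hl, hlen⟩ := exists_nbrList_append_length (G := G) u [v, s, w, t]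
        (by simp [hvw, hsv.symm, htv.symm, hsw, hst, htw.symm]) (by simp [*])
      obtain ⟨e, rfl⟩ := List.length_eq_one_iff.1 (show l.length = 1 by simp at hlen; omega)
      exact nwt (five_nonadj hG hr hl nvs)
  · obtain ⟨l, hl, hlen⟩ := exists_nbrList_append_length (G := G) u [v, w]
      (by simp [hvw]) (by simp [*])
    obtain ⟨p, q, r, rfl⟩ := List.length_eq_three.1 (show l.length = 3 by simp at hlen; omega)
    exact five_seven_nonadj hG hr hl nvw hv hw

/-! ### Neighbours of degree 7 of a 6-vertex -/

theorem conf_six_seven_universal (hG : NoReducible G) {u v a b c d e x : V}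
    (hu : NbrList G u [v, a, b, c, d, e]) (hv : NbrList G v [u, a, b, c, d, e, x])
    (eac : G.Adj a c) (ead : G.Adj a d) (ebc : G.Adj b c) (ebd : G.Adj b d) : False :=
  hG.false_of_certificate [u, v, a, b, c, d, e, x]
    [(0, [1, 2, 3, 4, 5, 6]), (1, [0, 2, 3, 4, 5, 6, 7])] [(2, 4), (2, 5), (3, 4), (3, 5)] [] []
    [(0, 2, 4), (0, 3, 5), (1, 2, 5), (1, 3, 4), (0, 1, 6)]
    [(2, 3), (2, 4), (2, 5), (3, 4), (3, 5), (4, 5), (0, 1), (1, 6), (1, 7), (0, 6)]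

theorem conf_six_two_sevens (hG : NoReducible G) {u v w a b c d x y z t : V}
    (hu : NbrList G u [v, w, a, b, c, d]) (hv : NbrList G v [u, a, b, c, d, x, y])
    (hw : NbrList G w [u, a, b, c, d, z, t]) (eac : G.Adj a c) (ebc : G.Adj b c) (ebd : G.Adj b d)
    (nab : ¬ G.Adj a b) (ncd : ¬ G.Adj c d) : False :=
  hG.false_of_certificate [u, v, w, a, b, c, d, x, y, z, t]
    [(0, [1, 2, 3, 4, 5, 6]), (1, [0, 3, 4, 5, 6, 7, 8]), (2, [0, 3, 4, 5, 6, 9, 10])]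
    [(3, 5), (4, 5), (4, 6)] [(3, 4), (5, 6)] []
    [(0, 1, 3), (0, 2, 6), (0, 4, 5), (1, 4, 6), (2, 3, 5)]
    [(4, 5), (4, 6), (3, 5), (3, 6), (1, 7), (1, 8), (2, 9), (2, 10), (0, 1), (0, 2)]

/-- A neighbour of degree 7 of a 6-vertex `u` is not adjacent to all other neighbours of `u`. -/
theorem six_seven_universal [Finite V] (hG : NoReducible G) (hr : IsRobust G) {u v a b c d e : V}
    (hu : NbrList G u [v, a, b, c, d, e]) (hv : (G.neighborSet v).ncard = 7)
    (hadj : ∀ s ∈ [a, b, c, d, e], G.Adj v s) : False := by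
  have hvu : G.Adj v u := (hu.adj (by simp)).symm
  obtain ⟨l, hl, hlen⟩ := exists_nbrList_append_length (G := G) v [u, a, b, c, d, e]
    (List.nodup_cons.2 ⟨fun h => G.irrefl (hu.adj (List.mem_cons_of_mem _ h)),
      (List.nodup_cons.1 hu.1).2⟩) (List.forall_mem_cons.2 ⟨hvu, hadj⟩)
  obtain ⟨x, rfl⟩ := List.length_eq_one_iff.1 (show l.length = 1 by simp at hlen; omega)
  obtain ⟨a', b', c', d', hp, ac, ad, bc, bd, -⟩ := hu.isLow.exists_four_cycle hG hr
    (a := a) (b := b) (c := c) (d := d)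
    (List.Nodup.of_append_left (l₂ := [e]) (List.nodup_cons.1 hu.1).2)
    (fun x hx => hu.adj (List.mem_cons_of_mem _ (List.mem_append_left [e] hx)))
  exact conf_six_seven_universal hG (hu.perm ((hp.append_right [e]).cons v))
    (hl.perm ((hp.append_right [e, x]).cons u)) ac ad bc bd

/-- A 6-vertex has at most four neighbours of degree 7. -/
theorem six_at_most_four_seven [Finite V] (hG : NoReducible G) (hr : IsRobust G)
    {u a b c d e f : V} (hu : NbrList G u [a, b, c, d, e, f])
    (h7 : ∀ s ∈ [a, b, c, d, e], (G.neighborSet s).ncard = 7) : False := by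
  have hnon : ∀ {a b c d e f}, NbrList G u [a, b, c, d, e, f] → (G.neighborSet a).ncard = 7 →
      ¬ G.Adj a b ∨ ¬ G.Adj a c ∨ ¬ G.Adj a d ∨ ¬ G.Adj a e ∨ ¬ G.Adj a f := by
    intro a b c d e f hu ha
    by_contra! hc
    exact six_seven_universal hG hr hu ha (by simpa using hc)
  -- an octahedron with two antipodal vertices of degree 7
  have octa : ∀ {a b c d e f}, NbrList G u [a, b, c, d, e, f] → (G.neighborSet a).ncard = 7 →
      (G.neighborSet b).ncard = 7 → ¬ G.Adj a b → ¬ G.Adj c d → G.Adj e f := by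
    intro a b c d e f hu ha hb nab ncd
    by_contra nef
    have hext : ∀ {a b}, NbrList G u [a, b, c, d, e, f] → (G.neighborSet a).ncard = 7 →
        ¬ G.Adj a b → ∃ x y, NbrList G a [u, c, d, e, f, x, y] := by
      intro a b hu ha nab
      have hac : ∀ i (hi : i < 6) (hi' : 2 ≤ i), G.Adj a ([a, b, c, d, e, f][i]) :=
        fun i hi hi' => (hu.adj_or hG hr 0 1 i (by simp)
          ⟨by simp, by simp, hi⟩ (by omega)).resolve_left nab
      obtain ⟨l, hl, hlen⟩ := exists_nbrList_append_length (G := G) a [u, c, d, e, f]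
        (hu.nodup_cons.sublist (by simp))
        (by simpa [(hu.adj (x := a) (by simp)).symm] using
          ⟨hac 2 (by simp) (by simp), hac 3 (by simp) (by simp), hac 4 (by simp) (by simp),
            hac 5 (by simp) (by simp)⟩)
      obtain ⟨x, y, rfl⟩ := List.length_eq_two.1 (show l.length = 2 by simp at hlen; omega)
      exact ⟨x, y, hl⟩
    obtain ⟨x, y, hla⟩ := hext hu ha nab
    obtain ⟨z, t, hlb⟩ := hext (a := b) (b := a) hu.reorder hb fun e => nab e.symm
    have ndc : ¬ G.Adj d c := fun e => ncd e.symm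
    exact conf_six_two_sevens hG hu hla hlb ((hu.adj_or hG hr 2 3 4).resolve_left ncd)
      ((hu.adj_or hG hr 3 2 4).resolve_left ndc) ((hu.adj_or hG hr 3 2 5).resolve_left ndc) ncd nef
  have main : ∀ {a b c d e f}, NbrList G u [a, b, c, d, e, f] →
      (∀ s ∈ [a, b, c, d, e], (G.neighborSet s).ncard = 7) → G.Adj a b := by
    intro a b c d e f hu h7
    by_contra nab
    have nba : ¬ G.Adj b a := fun e => nab e.symm
    simp only [List.mem_cons, List.not_mem_nil, or_false, forall_eq_or_imp, forall_eq] at h7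
    obtain ⟨ha, hb, hc, hd, he⟩ := h7
    have cd : ∀ {c d e f}, NbrList G u [a, b, c, d, e, f] → (G.neighborSet e).ncard = 7 →
        G.Adj c d := by
      intro c d e f hu he
      by_contra ncd
      have ndc : ¬ G.Adj d c := fun e => ncd e.symm
      have ae := (hu.adj_or hG hr 0 1 4).resolve_left nab
      have be := (hu.adj_or hG hr 1 0 4).resolve_left nba
      have ce := (hu.adj_or hG hr 2 3 4).resolve_left ncd
      have de := (hu.adj_or hG hr 3 2 4).resolve_left ndc
      have ef := octa hu ha hb nab ncd
      rcases hnon (a := e) (b := a) (c := b) (d := c) (e := d) (f := f) hu.reorder he with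
        h | h | h | h | h
      · exact h ae.symm
      · exact h be.symm
      · exact h ce.symm
      · exact h de.symm
      · exact h ef
    rcases hnon (a := c) (b := a) (c := b) (d := d) (e := e) (f := f) hu.reorder hc with
      h | h | h | h | h
    · exact h ((hu.adj_or hG hr 0 1 2).resolve_left nab).symm
    · exact h ((hu.adj_or hG hr 1 0 2).resolve_left nba).symm
    · exact h (cd hu he)
    · exact h (cd (c := c) (d := e) (e := d) hu.reorder hd)
    · exact h (cd (c := c) (d := f) (e := d) (f := e) hu.reorder hd)
  simp only [List.mem_cons, List.not_mem_nil, or_false, forall_eq_or_imp, forall_eq] at h7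
  obtain ⟨ha, hb, hc, hd, he⟩ := h7
  have nadj : ∀ {a b c d e}, NbrList G u [a, b, c, d, e, f] → (G.neighborSet a).ncard = 7 →
      (G.neighborSet b).ncard = 7 → (G.neighborSet c).ncard = 7 → (G.neighborSet d).ncard = 7 →
      (G.neighborSet e).ncard = 7 → ¬ G.Adj a f := by
    intro a b c d e hu ha hb hc hd he
    rcases hnon hu ha with h | h | h | h | h
    · exact absurd (main hu (by simp [*])) h
    · exact absurd (main (a := a) (b := c) (c := b) (d := d) (e := e) hu.reorder (by simp [*])) h
    · exact absurd (main (a := a) (b := d) (c := b) (d := c) (e := e) hu.reorder (by simp [*])) h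
    · exact absurd (main (a := a) (b := e) (c := b) (d := c) (e := d) hu.reorder (by simp [*])) h
    · exact h
  exact (hu.adj_or hG hr 5 0 1).elim (fun h => nadj hu ha hb hc hd he h.symm)
    fun h => nadj (a := b) (b := a) hu.reorder hb ha hc hd he h.symm

/-! ### Discharging -/

theorem ncard_neighborSet_eq_degree [Fintype V] [DecidableRel G.Adj] (v : V) :
    (G.neighborSet v).ncard = G.degree v := by
  rw [Set.ncard_eq_toFinset_card', ← SimpleGraph.neighborFinset_def,
    G.card_neighborFinset_eq_degree]

theorem isLow_iff_degree [Fintype V] [DecidableRel G.Adj] {v : V} :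
    IsLow G v ↔ G.degree v = 5 ∨ G.degree v = 6 := by
  rw [IsLow, ncard_neighborSet_eq_degree]

section Counting

open Finset

variable [Fintype V] [DecidableEq V] [DecidableRel G.Adj]

/-- A low vertex `u` has at least `2 (7 - deg u)` neighbours of degree at least 8. -/
theorem low_card_high_nbrs (hG : NoReducible G) (hr : IsRobust G) {u : V} (hu : IsLow G u) :
    14 ≤ 2 * G.degree u + #{x ∈ G.neighborFinset u | 8 ≤ G.degree x} := by
  set S : Finset V := {x ∈ G.neighborFinset u | G.degree x = 7} with hS
  have hsplit : #S + #{x ∈ G.neighborFinset u | 8 ≤ G.degree x} = G.degree u := by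
    rw [← G.card_neighborFinset_eq_degree u, ← Finset.card_union_of_disjoint]
    · congr 1
      ext x
      simp only [hS, mem_union, mem_filter, ← and_or_left, and_iff_left_iff_imp]
      intro hx
      rw [G.mem_neighborFinset] at hx
      have h5 := five_le_degree hG hr x
      have hx' : ¬ IsLow G x := fun h => hu.not_adj hG hr h hx
      rw [isLow_iff_degree] at hx'
      rw [ncard_neighborSet_eq_degree] at h5
      omega
    · rw [Finset.disjoint_left]
      intro x hx hx'
      simp only [hS, mem_filter] at hx hx'
      omega
  have hmem : ∀ {x}, x ∈ S → G.Adj u x ∧ (G.neighborSet x).ncard = 7 := by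
    intro x hx
    simpa [hS, ncard_neighborSet_eq_degree] using hx
  rcases hu with hu | hu
  · have hS1 : #S ≤ 1 := by
      refine Finset.card_le_one.2 fun v hv w hw => ?_
      by_contra hvw
      exact five_at_most_one_seven hG hr hu (hmem hv).1 (hmem hw).1 hvw (hmem hv).2 (hmem hw).2
    rw [ncard_neighborSet_eq_degree] at hu
    omega
  · have hS4 : #S ≤ 4 := by
      by_contra! h
      obtain ⟨T, hTS, hT⟩ := Finset.exists_subset_card_eq (show 5 ≤ #S from h)
      obtain ⟨l, hl, hlen⟩ := exists_nbrList_append_length (G := G) u T.toList T.nodup_toList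
        fun x hx => (hmem (hTS (T.mem_toList.1 hx))).1
      have hall : ∀ x ∈ T.toList, (G.neighborSet x).ncard = 7 :=
        fun x hx => (hmem (hTS (T.mem_toList.1 hx))).2
      have hTl := T.length_toList
      generalize T.toList = t at *
      rw [hT] at hTl
      obtain ⟨a, t, rfl⟩ := List.exists_of_length_succ t hTl
      obtain ⟨b, c, d, e, rfl⟩ := List.length_eq_four.1 (show t.length = 4 by simpa using hTl)
      obtain ⟨f, rfl⟩ := List.length_eq_one_iff.1 (show l.length = 1 by simp at hlen; omega)
      exact six_at_most_four_seven hG hr hl hall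
    rw [ncard_neighborSet_eq_degree] at hu
    omega

/-- A low neighbour `u` of `v` has at least four common neighbours with `v`, unless `u` has degree 5
and one of its other neighbours is not adjacent to `v`. -/
theorem low_card_common (hG : NoReducible G) (hr : IsRobust G) {u v : V} (hu : IsLow G u)
    (huv : G.Adj u v) : 4 ≤ #(G.neighborFinset u ∩ G.neighborFinset v) ∨
      3 ≤ #(G.neighborFinset u ∩ G.neighborFinset v) ∧ G.degree u = 5 ∧
        ∃ d, G.Adj u d ∧ d ≠ v ∧ ¬ G.Adj v d := by
  have hv : v ∈ G.neighborFinset u := by simpa using huv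
  have hcard : #((G.neighborFinset u).erase v) + 1 = G.degree u := by
    rw [Finset.card_erase_add_one hv, G.card_neighborFinset_eq_degree]
  by_cases hd : ∃ d, G.Adj u d ∧ d ≠ v ∧ ¬ G.Adj v d
  · have hd' := hd
    obtain ⟨d, hud, hdv, nvd⟩ := hd
    have hsub : ((G.neighborFinset u).erase v).erase d ⊆
        G.neighborFinset u ∩ G.neighborFinset v := by
      intro x hx
      simp only [mem_erase, mem_inter, G.mem_neighborFinset] at hx ⊢
      exact ⟨hx.2.2, (hu.adj_or_adj hG hr huv hud hx.2.2 hdv.symm (Ne.symm hx.2.1)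
        (Ne.symm hx.1)).resolve_left nvd⟩
    have h1 := Finset.card_le_card hsub
    have h2 : #(((G.neighborFinset u).erase v).erase d) + 1 = #((G.neighborFinset u).erase v) :=
      Finset.card_erase_add_one (by simp [hdv, hud])
    rw [isLow_iff_degree] at hu
    rcases hu with hu | hu
    · exact Or.inr ⟨by omega, hu, hd'⟩
    · left; omega
  · push Not at hd
    have hsub : (G.neighborFinset u).erase v ⊆ G.neighborFinset u ∩ G.neighborFinset v := by
      intro x hx
      simp only [mem_erase, mem_inter, G.mem_neighborFinset] at hx ⊢
      exact ⟨hx.2, hd x hx.2 hx.1⟩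
    have h1 := Finset.card_le_card hsub
    rw [isLow_iff_degree] at hu
    left; omega

theorem low_card_inter_le_two (hG : NoReducible G) (hr : IsRobust G) {u v w : V} (hu : IsLow G u)
    (hw : IsLow G w) (huw : u ≠ w) (huv : G.Adj u v) (hwv : G.Adj w v) :
    #((G.neighborFinset u ∩ G.neighborFinset v) ∩
      (G.neighborFinset w ∩ G.neighborFinset v)) ≤ 2 := by
  by_contra! h
  obtain ⟨a, b, c, ha, hb, hc, hab, hac, hbc⟩ := Finset.two_lt_card_iff.1 h
  simp only [mem_inter, G.mem_neighborFinset] at ha hb hc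
  refine hu.false_of_four_common hG hr hw huw (a := v) (b := a) (c := b) (d := c) ?_ ?_ ?_
  · simp [hab, hac, hbc, ha.1.2.ne, hb.1.2.ne, hc.1.2.ne]
  · simp [huv, ha, hb, hc]
  · simp [hwv, ha, hb, hc]

theorem low_card_inter_le_one (hG : NoReducible G) (hr : IsRobust G) {u v w d : V}
    (hu : G.degree u = 5) (hud : G.Adj u d) (hdv : d ≠ v) (nvd : ¬ G.Adj v d)
    (hw : IsLow G w) (huw : u ≠ w) (huv : G.Adj u v) (hwv : G.Adj w v) :
    #((G.neighborFinset u ∩ G.neighborFinset v) ∩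
      (G.neighborFinset w ∩ G.neighborFinset v)) ≤ 1 := by
  by_contra! h
  obtain ⟨a, b, ha, hb, hab⟩ := Finset.one_lt_card_iff.1 h
  simp only [mem_inter, G.mem_neighborFinset] at ha hb
  have had : a ≠ d := by rintro rfl; exact nvd ha.1.2
  have hbd : b ≠ d := by rintro rfl; exact nvd hb.1.2
  obtain ⟨l, hl, hlen⟩ := exists_nbrList_append_length (G := G) u [v, a, b, d]
    (by simp [hab, had, hbd, hdv.symm, ha.1.2.ne, hb.1.2.ne]) (by simp [huv, ha, hb, hud])
  rw [ncard_neighborSet_eq_degree] at hlen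
  obtain ⟨c, rfl⟩ := List.length_eq_one_iff.1 (show l.length = 1 by simp at hlen; omega)
  exact five_low_false_of_two_common hG hr (v := v) (a := a) (b := b) (c := c) (d := d) hl.reorder
    nvd hw huw hwv ha.2.1 hb.2.1

/-- A vertex of degree `d ≥ 8` has at most `2 (d - 7)` low neighbours. -/
theorem high_card_low_nbrs (hG : NoReducible G) (hr : IsRobust G) [DecidablePred (IsLow G)] {v : V}
    (hv : 8 ≤ G.degree v) :
    #{u ∈ G.neighborFinset v | IsLow G u} + 14 ≤ 2 * G.degree v := by
  set L : Finset V := {u ∈ G.neighborFinset v | IsLow G u} with hL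
  by_cases hL2 : #L ≤ 2
  · omega
  set C : Finset V := {u ∈ G.neighborFinset v | ¬ IsLow G u} with hC
  have hLC : #L + #C = G.degree v := by
    rw [hL, hC, Finset.card_filter_add_card_filter_not, G.card_neighborFinset_eq_degree]
  suffices 6 ≤ #C by omega
  have hmem : ∀ {u}, u ∈ L → G.Adj u v ∧ IsLow G u := by
    intro u hu
    simp only [hL, mem_filter, G.mem_neighborFinset] at hu
    exact ⟨hu.1.symm, hu.2⟩
  have hsub : ∀ {u}, u ∈ L → G.neighborFinset u ∩ G.neighborFinset v ⊆ C := by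
    intro u hu x hx
    simp only [mem_inter, G.mem_neighborFinset, hC, mem_filter] at hx ⊢
    exact ⟨hx.2, fun hlow => (hmem hu).2.not_adj hG hr hlow hx.1⟩
  obtain ⟨u, w, t, hu, hw, ht, huw, hut, hwt⟩ := Finset.two_lt_card_iff.1 (not_le.1 hL2)
  have htwo : ∀ {u w}, u ∈ L → w ∈ L → u ≠ w → #((G.neighborFinset u ∩ G.neighborFinset v) ∩
      (G.neighborFinset w ∩ G.neighborFinset v)) ≤ 2 := fun hu hw huw =>
    low_card_inter_le_two hG hr (hmem hu).2 (hmem hw).2 huw (hmem hu).1 (hmem hw).1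
  have hone : ∀ {u w}, u ∈ L → w ∈ L → u ≠ w →
      4 ≤ #(G.neighborFinset u ∩ G.neighborFinset v) ∨
      3 ≤ #(G.neighborFinset u ∩ G.neighborFinset v) ∧
      #((G.neighborFinset u ∩ G.neighborFinset v) ∩
      (G.neighborFinset w ∩ G.neighborFinset v)) ≤ 1 := by
    intro u w hu hw huw
    rcases low_card_common hG hr (hmem hu).2 (hmem hu).1 with h | ⟨h, h5, d, hud, hdv, nvd⟩
    · exact Or.inl h
    · exact Or.inr ⟨h, low_card_inter_le_one hG hr h5 hud hdv nvd (hmem hw).2 huw (hmem hu).1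
        (hmem hw).1⟩
  have huw2 := htwo hu hw huw
  have h1 := hone hu hw huw
  have h2 := hone hu ht hut
  have h3 := hone hw hu huw.symm
  have h4 := hone hw ht hwt
  have h5 := hone ht hu hut.symm
  have h6 := hone ht hw hwt.symm
  have hut2 := htwo hu ht hut
  have hsu := hsub hu
  have hsw := hsub hw
  have hst := hsub ht
  set A := G.neighborFinset u ∩ G.neighborFinset v
  set B := G.neighborFinset w ∩ G.neighborFinset v
  set D := G.neighborFinset t ∩ G.neighborFinset v
  rw [Finset.inter_comm B A] at h3
  rw [Finset.inter_comm D A] at h5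
  rw [Finset.inter_comm D B] at h6
  have hAB := Finset.card_union_add_card_inter A B
  have hABC := Finset.card_le_card (Finset.union_subset hsu hsw)
  by_cases h : 6 ≤ #(A ∪ B)
  · omega
  have hAD := Finset.card_union_add_card_inter A D
  have hADC := Finset.card_le_card (Finset.union_subset hsu hst)
  by_cases h' : 6 ≤ #(A ∪ D)
  · omega
  -- now the three sets have three elements each and pairwise meet in at most one
  have hABD := Finset.card_union_add_card_inter (A ∪ B) D
  have hABDC := Finset.card_le_card (Finset.union_subset (Finset.union_subset hsu hsw) hst)
  have hle : #((A ∪ B) ∩ D) ≤ #(A ∩ D) + #(B ∩ D) := by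
    rw [Finset.union_inter_distrib_right]
    exact Finset.card_union_le _ _
  omega

/-- The average degree of `G` is at least 7. -/
theorem seven_mul_card_le (hG : NoReducible G) (hr : IsRobust G) :
    7 * Fintype.card V ≤ 2 * #G.edgeFinset := by
  classical
  rw [← G.sum_degrees_eq_twice_card_edges]
  have hdc : ∑ u : V with IsLow G u, #{x ∈ G.neighborFinset u | 8 ≤ G.degree x} =
      ∑ x : V with 8 ≤ G.degree x, #{u ∈ G.neighborFinset x | IsLow G u} := by
    have := Finset.sum_card_bipartiteAbove_eq_sum_card_bipartiteBelow (r := G.Adj)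
      (s := ({u | IsLow G u} : Finset V)) (t := ({x | 8 ≤ G.degree x} : Finset V))
    convert this using 2 with u hu x hx
    · congr 1; ext x; simp [bipartiteAbove, and_comm]
    · congr 1; ext u; simp [bipartiteBelow, and_comm, G.adj_comm]
  rw [Finset.sum_filter, Finset.sum_filter] at hdc
  have key : ∀ v : V, (14 + if 8 ≤ G.degree v then #{u ∈ G.neighborFinset v | IsLow G u} else 0) ≤
      2 * G.degree v + if IsLow G v then #{x ∈ G.neighborFinset v | 8 ≤ G.degree x} else 0 := by
    intro v
    have h5 := five_le_degree hG hr v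
    rw [ncard_neighborSet_eq_degree] at h5
    by_cases hlow : IsLow G v
    · have := low_card_high_nbrs hG hr hlow
      have hlow' := isLow_iff_degree.1 hlow
      rw [if_neg (by omega), if_pos hlow]
      omega
    · rw [if_neg hlow]
      rw [isLow_iff_degree] at hlow
      split_ifs with h8
      · have := high_card_low_nbrs hG hr h8
        omega
      · omega
  have hsum := Finset.sum_le_sum fun v (_ : v ∈ (Finset.univ : Finset V)) => key v
  rw [Finset.sum_add_distrib, Finset.sum_add_distrib, hdc, ← Finset.mul_sum, Finset.sum_const,
    Finset.card_univ, smul_eq_mul] at hsum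
  omega

end Counting

end Tuza

theorem mainTheorem4 {V : Type*} [Finite V] [Nonempty V] (G : SimpleGraph V)
    (hrobust : Tuza.IsRobust G) (havg : Tuza.averageDegree G < 7) :
    ∃ V₀ : Set V, Tuza.IsReducible G V₀ := by
  classical
  by_contra hG
  have := Fintype.ofFinite V
  have hle := Tuza.seven_mul_card_le hG hrobust
  rw [Tuza.averageDegree, ← G.coe_edgeFinset, Set.ncard_coe_finset, Nat.card_eq_fintype_card,
    div_lt_iff₀ (by exact_mod_cast Fintype.card_pos)] at havg
  exact absurd (by exact_mod_cast havg) (not_lt.2 hle)
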